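/- Let $L$ be an integral lattice, i.e. a free abelian group of finite rank with a symmetric bilinear form $(\cdot|\cdot)\colon L\times L\to\mathbb{Z}$, extended $\mathbb{C}$-bilinearly to $\mathfrak{h}=\mathbb{C}\otimes_{\mathbb{Z}}L$; write $|a|^2=(a|a)$. Let $V_L=\mathbb{C}_\varepsilon[L]\otimes S(\mathfrak{h}[t^{-1}]t^{-1})$ be the lattice vertex (super)algebra of $L$, where $\varepsilon\colon L\times L\to\{\pm1\}$ is bimultiplicative with $\varepsilon(a,a)=(-1)^{|a|^2(|a|^2+1)/2}$, with its Heisenberg fields $a(z)=\sum_n a_{(n)}z^{-n-1}$ ($a\in\mathfrak{h}$) and vertex operators $$e^{\nu}(z)=e^{\nu}z^{\nu_{(0)}}\exp\Bigl(\sum_{n\ge1}\nu_{(-n)}\tfrac{z^n}{n}\Bigr)\exp\Bigl(-\sum_{n\ge1}\nu_{(n)}\tfrac{z^{-n}}{n}\Bigr)\qquad(\nu\in L).$$ Let $k\in\mathbb{C}$, let $\delta\in L$ with $|\delta|^2=0$, and let $\alpha,\beta,\gamma\in\mathfrak{h}$ be such that $\alpha,\beta,\gamma,\delta$ span $\mathfrak{h}$.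 Consider the fields $$e(z)={:}\alpha(z)e^{\delta}(z){:},\qquad h(z)=\beta(z),\qquad f(z)={:}\gamma(z)e^{-\delta}(z){:}$$ on $V_L$. We say that they provide an embedding of $\widehat{\mathfrak{sl}}_2=\mathfrak{sl}_2\otimes\mathbb{C}[t,t^{-1}]\oplus\mathbb{C}K$, with $[xt^m,yt^n]=[x,y]t^{m+n}+m\,\delta_{m,-n}\operatorname{tr}(xy)K$ and $K$ central, of level $k$ in $V_L$ if $et^n\mapsto e_{(n)}$, $ht^n\mapsto h_{(n)}$, $ft^n\mapsto f_{(n)}$ ($n\in\mathbb{Z}$), $K\mapsto k\cdot\mathrm{id}$ defines a representation of $\widehat{\mathfrak{sl}}_2$ on $V_L$ in which only elements of $\mathbb{C}K$ may act as zero. **Theorem 2.1.** These fields provide an embedding of $\widehat{\mathfrak{sl}}_2$ of level $k$ in $V_L$ if and only if, up to the rescaling $e\mapsto\lambda e$, $f\mapsto\lambda^{-1}f$, $h\mapsto h$, that is, after replacing $(\alpha,\gamma)$ by $(\lambda\alpha,\lambda^{-1}\gamma)$ for some nonzero $\lambda\in\mathbb{C}$, one has $$\beta=k\delta+\alpha-\gamma,\qquad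 |\delta|^2=0,\qquad (\alpha|\gamma)=k+1,\qquad |\alpha|^2=|\gamma|^2=(\delta|\alpha)=-(\delta|\gamma)=1.$$ -/

import Mathlib

open scoped TensorProduct

noncomputable section

/-! ## The affine Kac–Moody algebra of type `A₁⁽¹⁾` -/

namespace AffineSl2

attribute [local instance] LieRing.ofAssociativeRing

/-- The Lie algebra `𝔰𝔩₂` of traceless complex `2 × 2` matrices. -/
abbrev Sl2 : Type := LieAlgebra.SpecialLinear.sl (Fin 2) ℂ

/-- The standard generator `e = E₁₂`. -/
def e : Sl2 := LieAlgebra.SpecialLinear.single 0 1 (by decide) 1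

/-- The standard generator `h = E₁₁ - E₂₂`. -/
def h : Sl2 := LieAlgebra.SpecialLinear.singleSubSingle 0 1 1

/-- The standard generator `f = E₂₁`. -/
def f : Sl2 := LieAlgebra.SpecialLinear.single 1 0 (by decide) 1

/-- The negative `(x, y) ↦ -tr (x y)` of the trace form. The sign is there because the cocycle
that Mathlib attaches to a form `Φ` is `Res x dy`, while the bracket of the affine
algebra is normalized by `Res dx y = -Res x dy`; see `lie_loop_loop` below. -/
def negTraceForm : LinearMap.BilinForm ℂ Sl2 :=
  LinearMap.mk₂ ℂ (fun x y => -Matrix.trace (x.val * y.val))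
    (fun x x' y => by simp [add_mul, add_comm])
    (fun c x y => by simp)
    (fun x y y' => by simp [mul_add, add_comm])
    (fun c x y => by simp)

theorem negTraceForm_apply (x y : Sl2) : negTraceForm x y = -Matrix.trace (x.val * y.val) := rfl

theorem negTraceForm_isSymm : negTraceForm.IsSymm :=
  ⟨fun x y => by simp [negTraceForm_apply, Matrix.trace_mul_comm x.val y.val]⟩

theorem negTraceForm_lieInvariant : negTraceForm.lieInvariant Sl2 := by
  intro x y z
  simp only [negTraceForm_apply, LieAlgebra.SpecialLinear.sl_bracket, sub_mul, mul_sub,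
    Matrix.trace_sub]
  rw [Matrix.mul_assoc y.val x.val z.val, ← Matrix.mul_assoc y.val z.val x.val,
    Matrix.trace_mul_comm (y.val * z.val) x.val, Matrix.mul_assoc x.val y.val z.val]
  ring

/-- The affine Lie algebra `ŝl₂ = 𝔰𝔩₂ ⊗ ℂ[t, t⁻¹] ⊕ ℂ K`, the central extension of the loop
algebra of `𝔰𝔩₂` defined by the cocycle `(x tᵐ, y tⁿ) ↦ m δ_{m,-n} tr (x y)`. -/
abbrev Affine : Type :=
  LieAlgebra.ofTwoCocycle (LieAlgebra.LoopAlgebra.twoCocycleOfBilinear ℂ ℤ Sl2 negTraceForm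
    negTraceForm_lieInvariant negTraceForm_isSymm)

/-- The element `x tⁿ` of `ŝl₂`. -/
def loop (x : Sl2) (n : ℤ) : Affine :=
  LieAlgebra.ofProd _ (AddMonoidAlgebra.single n 1 ⊗ₜ[ℂ] x, 0)

/-- The central element `K` of `ŝl₂`. -/
def K : Affine :=
  LieAlgebra.ofProd _ (0, (TrivialLieModule.equiv ℂ (LieAlgebra.loopAlgebra ℂ ℤ Sl2) ℂ).symm 1)

/-- `[x tᵐ, y tⁿ] = [x, y] tᵐ⁺ⁿ + m δ_{m,-n} tr (x y) K`. -/
theorem lie_loop_loop (x y : Sl2) (m n : ℤ) :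
    ⁅loop x m, loop y n⁆ =
      loop ⁅x, y⁆ (m + n) + (if m + n = 0 then (m : ℂ) * Matrix.trace (x.val * y.val) else 0) • K := by
  have hres : LieAlgebra.LoopAlgebra.residuePairing ℂ ℤ Sl2 negTraceForm
      (AddMonoidAlgebra.single m 1 ⊗ₜ[ℂ] x) (AddMonoidAlgebra.single n 1 ⊗ₜ[ℂ] y) =
      if m + n = 0 then (m : ℂ) * Matrix.trace (x.val * y.val) else 0 := by
    rw [LieAlgebra.LoopAlgebra.residuePairing_apply_apply]
    simp only [LieAlgebra.LoopAlgebra.toFinsupp_single_tmul]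
    rw [Finsupp.sum_single_index (by simp)]
    split_ifs with h0
    · obtain rfl : n = -m := by omega
      simp [negTraceForm_apply]
    · rw [Finsupp.single_eq_of_ne (by omega)]
      simp
  rw [LieAlgebra.bracket_ofTwoCocycle]
  simp only [loop, K, Equiv.symm_apply_apply, ← LieAlgebra.of_smul, ← LieAlgebra.of_add]
  refine congrArg _ (Prod.ext ?_ ?_)
  · split_ifs <;>
      simp only [LieAlgebra.ExtendScalars.bracket_tmul, AddMonoidAlgebra.single_mul_single, mul_one,
        Prod.fst_add, Prod.smul_fst, smul_zero, add_zero, zero_smul]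
  · rw [← hres]
    simp only [Prod.snd_add, Prod.smul_snd, zero_add, ← map_smul, smul_eq_mul, mul_one, lie_zero,
      add_zero, sub_zero]
    rfl

/-- `K` is central. -/
theorem lie_K (u : Affine) : ⁅u, K⁆ = 0 := by
  rw [LieAlgebra.bracket_ofTwoCocycle, ← LieAlgebra.of_zero]
  refine congrArg _ (Prod.ext ?_ ?_)
  · simp [K]
  · simp [K, LieModule.IsTrivial.trivial]

/-- Three fields `E(z)`, `H(z)`, `F(z)` on a complex vector space `V` *provide an embedding of `ŝl₂`
of level `k`*: their modes `E_(n)`, `H_(n)`, `F_(n)` are the images of `e tⁿ`, `h tⁿ`, `f tⁿ` under a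
representation of `ŝl₂` on `V` in which `K` acts as the scalar `k`, and no element of `ŝl₂` outside
the line `ℂ K` acts as zero. -/
def IsEmbedding {V : Type*} [AddCommGroup V] [Module ℂ V] (k : ℂ) (E H F : VertexOperator ℂ V) :
    Prop :=
  ∃ ρ : Affine →ₗ⁅ℂ⁆ Module.End ℂ V,
    (∀ n : ℤ, ρ (loop e n) = VertexOperator.ncoeff E n) ∧
    (∀ n : ℤ, ρ (loop h n) = VertexOperator.ncoeff H n) ∧
    (∀ n : ℤ, ρ (loop f n) = VertexOperator.ncoeff F n) ∧
    ρ K = k • (1 : Module.End ℂ V) ∧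
    ∀ u : Affine, ρ u = 0 → u ∈ Submodule.span ℂ {K}

end AffineSl2

/-! ## Fields -/

namespace FieldCalculus

variable {V W : Type*} [AddCommGroup V] [Module ℂ V] [AddCommGroup W] [Module ℂ W]

/-- The sum `∑ᵢ Tᵢ` of a family of linear maps such that every vector is killed by all but finitely
many of them. -/
def locSum {ι : Type*} (T : ι → V →ₗ[ℂ] W) (hT : ∀ v, (Function.support fun i => T i v).Finite) :
    V →ₗ[ℂ] W where
  toFun v := ∑ᶠ i, T i v
  map_add' v w := by
    simp only [map_add]
    exact finsum_add_distrib (hT v) (hT w)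
  map_smul' c v := by
    simp only [map_smul, RingHom.id_apply]
    exact (smul_finsum' c (hT v)).symm

theorem locSum_apply {ι : Type*} (T : ι → V →ₗ[ℂ] W)
    (hT : ∀ v, (Function.support fun i => T i v).Finite) (v : V) :
    locSum T hT v = ∑ᶠ i, T i v := rfl

/-- The exponential `∑ⱼ xʲ / j!` of a power series without constant term, with coefficients in an
associative algebra that need not be commutative. (The coefficient of `zᵐ` of `xʲ` vanishes for
`j > m`.) -/
def expSeries {A : Type*} [Ring A] [Algebra ℂ A] (x : PowerSeries A) : PowerSeries A :=
  PowerSeries.mk fun m =>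
    ∑ j ∈ Finset.range (m + 1), ((j.factorial : ℂ)⁻¹) • PowerSeries.coeff m (x ^ j)

theorem exists_coeff_eq_zero (A : VertexOperator ℂ V) (v : V) :
    ∃ N : ℤ, ∀ n < N, HVertexOperator.coeff A n v = 0 :=
  ⟨_, fun n hn => VertexOperator.coeff_eq_zero_of_lt_order A n v hn⟩

/-- The summands of the normally ordered product. -/
def nopTerm (A B : VertexOperator ℂ V) (m i : ℤ) : Module.End ℂ V :=
  if 0 ≤ i then HVertexOperator.coeff A i * HVertexOperator.coeff B (m - i)
  else HVertexOperator.coeff B (m - i) * HVertexOperator.coeff A i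

theorem nopTerm_finite (A B : VertexOperator ℂ V) (m : ℤ) (v : V) :
    (Function.support fun i => nopTerm A B m i v).Finite := by
  obtain ⟨a, ha⟩ := exists_coeff_eq_zero A v
  obtain ⟨b, hb⟩ := exists_coeff_eq_zero B v
  refine (Set.finite_Icc (min a 0) (max (m - b) 0)).subset fun i hi => ?_
  rw [Function.mem_support] at hi
  by_contra hmem
  apply hi
  unfold nopTerm
  split_ifs with h0
  · rw [Module.End.mul_apply, hb (m - i), map_zero]
    by_contra hlt
    exact hmem ⟨(min_le_right _ _).trans h0, le_max_of_le_left (by omega)⟩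
  · rw [Module.End.mul_apply, ha i, map_zero]
    by_contra hlt
    exact hmem ⟨min_le_of_left_le (by omega), le_max_of_le_right (by omega)⟩

theorem nop_bddBelow (A B : VertexOperator ℂ V) (v : V) :
    BddBelow (Function.support fun m : ℤ => locSum (nopTerm A B m) (nopTerm_finite A B m) v) := by
  obtain ⟨a, ha⟩ := exists_coeff_eq_zero A v
  obtain ⟨b, hb⟩ := exists_coeff_eq_zero B v
  choose c hc using fun i : ℤ => exists_coeff_eq_zero B (HVertexOperator.coeff A i v)
  obtain ⟨d, hd⟩ : ∃ d : ℤ, ∀ i ∈ Finset.Ico a 0, d ≤ c i := by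
    obtain ⟨d, hd⟩ := ((Finset.Ico a 0).image c).bddBelow
    exact ⟨d, fun i hi => hd (by simpa using ⟨i, by simpa using hi, rfl⟩)⟩
  refine ⟨min b (d + a), fun m hm => ?_⟩
  rw [Function.mem_support, locSum_apply] at hm
  by_contra hlt
  rw [not_le, lt_min_iff] at hlt
  apply hm
  refine (finsum_congr fun i => ?_).trans finsum_zero
  unfold nopTerm
  split_ifs with h0
  · rw [Module.End.mul_apply, hb _ (by omega), map_zero]
  · rw [Module.End.mul_apply]
    by_cases hi : i < a
    · rw [ha i hi, map_zero]
    · have := hd i (by simp; omega)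
      exact hc i _ (by omega)

/-- The normally ordered product `:A(z)B(z): = A(z)₊ B(z) + B(z) A(z)₋` of two fields, where
`A(z)₊` collects the nonnegative and `A(z)₋` the negative powers of `z` in `A(z)`. -/
def nop (A B : VertexOperator ℂ V) : VertexOperator ℂ V :=
  VertexOperator.of_coeff (fun m => locSum (nopTerm A B m) (nopTerm_finite A B m))
    (nop_bddBelow A B)

end FieldCalculus

/-! ## Lattice vertex algebras -/

namespace LatticeVertexAlgebra

open FieldCalculus

variable {L : Type*} [AddCommGroup L]

/-- The cocycles used to twist the group algebra of an integral lattice `(L, B)`: bimultiplicative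
maps `ε : L × L → {±1}` with `ε(a, a) = (-1)^{|a|²(|a|² + 1)/2}`. They satisfy
`ε(a, b) ε(b, a) = (-1)^{(a|b) + |a|²|b|²}`. -/
structure Cocycle (B : LinearMap.BilinForm ℤ L) where
  /-- the value `ε(a, b)` -/
  val : L → L → ℤˣ
  add_left : ∀ a b c, val (a + b) c = val a c * val b c
  add_right : ∀ a b c, val a (b + c) = val a b * val a c
  self : ∀ a, val a a = (-1) ^ (B a a * (B a a + 1) / 2)

/-- The complexification `𝔥 = ℂ ⊗ L` of the lattice. -/
abbrev Cartan (L : Type*) [AddCommGroup L] : Type _ := ℂ ⊗[ℤ] L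

/-- The inclusion of `L` in `𝔥`. -/
def incl (l : L) : Cartan L := (1 : ℂ) ⊗ₜ[ℤ] l

/-- The complex bilinear extension of the form of the lattice to `𝔥`. -/
def form (B : LinearMap.BilinForm ℤ L) : LinearMap.BilinForm ℂ (Cartan L) := B.baseChange ℂ

theorem form_incl (B : LinearMap.BilinForm ℤ L) (l l' : L) :
    form B (incl l) (incl l') = (B l l' : ℂ) := by
  simp [form, incl]

/-- The bosonic Fock space `S(𝔥[t⁻¹]t⁻¹)`: the symmetric algebra on the elements
`a t⁻ⁿ⁻¹ = Finsupp.single n a` with `a ∈ 𝔥` and `n ≥ 0`. -/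
abbrev Fock (L : Type*) [AddCommGroup L] : Type _ := SymmetricAlgebra ℂ (ℕ →₀ Cartan L)

/-- The generator `a t⁻ⁿ⁻¹` of the Fock space. -/
def gen (n : ℕ) (a : Cartan L) : Fock L := SymmetricAlgebra.ι ℂ (ℕ →₀ Cartan L) (Finsupp.single n a)

/-- The linear functional `b t⁻ᵐ⁻¹ ↦ δ_{m,n} (n + 1) (a|b)` on `𝔥[t⁻¹]t⁻¹`. -/
def contract (B : LinearMap.BilinForm ℤ L) (n : ℕ) (a : Cartan L) : (ℕ →₀ Cartan L) →ₗ[ℂ] ℂ :=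
  ((n + 1 : ℂ) • form B a) ∘ₗ Finsupp.lapply n

/-- The homomorphism `s ↦ s + D(s) η` to the dual numbers over the Fock space (`η² = 0`) through
which the derivation `D` below is defined. -/
def annihilateHom (B : LinearMap.BilinForm ℤ L) (n : ℕ) (a : Cartan L) :
    Fock L →ₐ[ℂ] DualNumber (Fock L) :=
  SymmetricAlgebra.lift
    ((TrivSqZeroExt.inlAlgHom ℂ (Fock L) (Fock L)).toLinearMap ∘ₗ
        SymmetricAlgebra.ι ℂ (ℕ →₀ Cartan L) +
      (TrivSqZeroExt.inrHom (Fock L) (Fock L)).restrictScalars ℂ ∘ₗ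
        Algebra.linearMap ℂ (Fock L) ∘ₗ contract B n a)

theorem fst_annihilateHom (B : LinearMap.BilinForm ℤ L) (n : ℕ) (a : Cartan L) (s : Fock L) :
    (annihilateHom B n a s).fst = s := by
  have key : (TrivSqZeroExt.fstHom ℂ (Fock L) (Fock L)).comp (annihilateHom B n a) =
      AlgHom.id ℂ (Fock L) := by
    refine SymmetricAlgebra.algHom_ext (LinearMap.ext fun x => ?_)
    simp [annihilateHom]
  exact congrArg (fun g : Fock L →ₐ[ℂ] Fock L => g s) key

/-- The annihilation operator `a_(n+1)` on the Fock space, for `n ≥ 0`: the derivation determined by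
`a_(n+1) (b t⁻ᵐ⁻¹) = δ_{m,n} (n + 1) (a|b)`. -/
def annihilate (B : LinearMap.BilinForm ℤ L) (n : ℕ) (a : Cartan L) :
    Derivation ℂ (Fock L) (Fock L) :=
  Derivation.mk'
    ((TrivSqZeroExt.sndHom (Fock L) (Fock L)).restrictScalars ℂ ∘ₗ
      (annihilateHom B n a).toLinearMap)
    (fun s t => by simp [fst_annihilateHom, mul_comm])

theorem annihilate_gen (B : LinearMap.BilinForm ℤ L) (n m : ℕ) (a b : Cartan L) :
    annihilate B n a (gen m b) =
      algebraMap ℂ (Fock L) (if m = n then (n + 1 : ℂ) * form B a b else 0) := by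
  have h1 : annihilate B n a (gen m b) =
      algebraMap ℂ (Fock L) (contract B n a (Finsupp.single m b)) := by
    simp [annihilate, annihilateHom, gen, Algebra.algebraMap_eq_smul_one]
  rw [h1]
  congr 1
  by_cases h : m = n
  · simp [contract, h]
  · simp [contract, h, Finsupp.single_eq_of_ne (Ne.symm h)]

/-- The span of the monomials of weight at most `N`, where `a t⁻ⁿ⁻¹` has weight `n + 1`. It serves
to show that the infinite sums below are finite on every vector. -/
def weightLE (L : Type*) [AddCommGroup L] (N : ℤ) : Submodule ℂ (Fock L) :=
  Submodule.span ℂ {s | ∃ l : List (ℕ × Cartan L),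
    (l.map fun p => gen p.1 p.2).prod = s ∧ (l.map fun p => (p.1 + 1 : ℤ)).sum ≤ N}

theorem weightLE_mono {M N : ℤ} (h : M ≤ N) : weightLE L M ≤ weightLE L N :=
  Submodule.span_mono fun _ ⟨l, h1, h2⟩ => ⟨l, h1, h2.trans h⟩

theorem weightLE_of_neg {N : ℤ} (h : N < 0) : weightLE L N = ⊥ := by
  rw [weightLE, Submodule.span_eq_bot]
  rintro s ⟨l, -, hl⟩
  have : 0 ≤ (l.map fun p => (p.1 + 1 : ℤ)).sum := by
    refine List.sum_nonneg fun x hx => ?_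
    obtain ⟨p, -, rfl⟩ := List.mem_map.1 hx
    positivity
  omega

theorem one_mem_weightLE : (1 : Fock L) ∈ weightLE L 0 :=
  Submodule.subset_span ⟨[], by simp, by simp⟩

theorem gen_mem_weightLE (n : ℕ) (a : Cartan L) : gen n a ∈ weightLE L (n + 1) :=
  Submodule.subset_span ⟨[(n, a)], by simp, by simp⟩

theorem mul_mem_weightLE {M N : ℤ} {s t : Fock L} (hs : s ∈ weightLE L M) (ht : t ∈ weightLE L N) :
    s * t ∈ weightLE L (M + N) := by
  have := Submodule.mul_mem_mul hs ht
  rw [weightLE, weightLE, Submodule.span_mul_span] at this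
  refine Submodule.span_mono ?_ this
  rintro _ ⟨_, ⟨l, rfl, hl⟩, _, ⟨l', rfl, hl'⟩, rfl⟩
  exact ⟨l ++ l', by simp, by simpa using add_le_add hl hl'⟩

theorem exists_mem_weightLE (s : Fock L) : ∃ N : ℤ, s ∈ weightLE L N := by
  induction s using SymmetricAlgebra.induction with
  | algebraMap r =>
    exact ⟨0, by rw [Algebra.algebraMap_eq_smul_one]; exact Submodule.smul_mem _ _ one_mem_weightLE⟩
  | ι x =>
    induction x using Finsupp.induction_linear with
    | zero => exact ⟨0, by simp⟩
    | add x y hx hy =>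
      obtain ⟨M, hM⟩ := hx
      obtain ⟨N, hN⟩ := hy
      refine ⟨max M N, ?_⟩
      rw [map_add]
      exact Submodule.add_mem _ (weightLE_mono (le_max_left _ _) hM)
        (weightLE_mono (le_max_right _ _) hN)
    | single n a => exact ⟨n + 1, gen_mem_weightLE n a⟩
  | mul s t hs ht =>
    obtain ⟨M, hM⟩ := hs
    obtain ⟨N, hN⟩ := ht
    exact ⟨M + N, mul_mem_weightLE hM hN⟩
  | add s t hs ht =>
    obtain ⟨M, hM⟩ := hs
    obtain ⟨N, hN⟩ := ht
    exact ⟨max M N, Submodule.add_mem _ (weightLE_mono (le_max_left _ _) hM)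
      (weightLE_mono (le_max_right _ _) hN)⟩

theorem annihilate_mem_weightLE (B : LinearMap.BilinForm ℤ L) (n : ℕ) (a : Cartan L) {N : ℤ}
    {s : Fock L} (hs : s ∈ weightLE L N) : annihilate B n a s ∈ weightLE L (N - (n + 1)) := by
  induction hs using Submodule.span_induction with
  | mem s hs =>
    obtain ⟨l, rfl, hl⟩ := hs
    refine weightLE_mono (sub_le_sub_right hl _) ?_
    clear hl
    induction l with
    | nil => simp
    | cons p l ih =>
      simp only [List.map_cons, List.prod_cons, List.sum_cons, Derivation.leibniz, smul_eq_mul]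
      refine Submodule.add_mem _ ?_ ?_
      · have := mul_mem_weightLE (gen_mem_weightLE p.1 p.2) ih
        rwa [← add_sub_assoc] at this
      · rw [annihilate_gen]
        split_ifs with h
        · rw [mul_comm, ← Algebra.smul_def, h, add_sub_cancel_left]
          exact Submodule.smul_mem _ _ (Submodule.subset_span ⟨l, rfl, le_rfl⟩)
        · simp
  | zero => simp
  | add s t _ _ hs ht => rw [map_add]; exact Submodule.add_mem _ hs ht
  | smul c s _ hs => rw [Derivation.map_smul]; exact Submodule.smul_mem _ _ hs

/-- The space `V_L = ℂ_ε[L] ⊗ S(𝔥[t⁻¹]t⁻¹)`; the vector `e^μ ⊗ s` is `Finsupp.single μ s`. -/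
abbrev Space (L : Type*) [AddCommGroup L] : Type _ := L →₀ Fock L

/-- The mode `a_(n)` of the Heisenberg field `a(z)`, for `a ∈ 𝔥`, on `V_L`: multiplication by
`a tⁿ` for `n < 0`, a derivation for `n > 0`, and `(a|μ)` on `e^μ ⊗ S(𝔥[t⁻¹]t⁻¹)` for `n = 0`. -/
def heisMode (B : LinearMap.BilinForm ℤ L) (a : Cartan L) : ℤ → Module.End ℂ (Space L)
  | Int.ofNat 0 => Finsupp.lsum ℂ fun μ => form B a (incl μ) • Finsupp.lsingle μ
  | Int.ofNat (n + 1) => Finsupp.mapRange.linearMap (annihilate B n a : Fock L →ₗ[ℂ] Fock L)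
  | Int.negSucc n => Finsupp.mapRange.linearMap (LinearMap.mulLeft ℂ (gen n a))

theorem heisMode_bddBelow (B : LinearMap.BilinForm ℤ L) (a : Cartan L) (v : Space L) :
    BddBelow (Function.support fun m : ℤ => heisMode B a (-m - 1) v) := by
  choose N hN using fun s : Fock L => exists_mem_weightLE s
  obtain ⟨M, hM⟩ := (v.support.image fun μ => N (v μ)).bddAbove
  refine ⟨min (-M - 1) (-1), fun m hm => ?_⟩
  rw [Function.mem_support] at hm
  by_contra hlt
  rw [not_le, lt_min_iff] at hlt
  apply hm
  obtain ⟨n, hn⟩ : ∃ n : ℕ, -m - 1 = Int.ofNat (n + 1) :=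
    ⟨(-m - 2).toNat, by simp only [Int.ofNat_eq_natCast]; omega⟩
  rw [hn]
  simp only [Int.ofNat_eq_natCast] at hn
  ext μ
  simp only [heisMode, Finsupp.mapRange.linearMap_apply, Finsupp.mapRange_apply, Finsupp.zero_apply]
  by_cases hμ : v μ = 0
  · simp [hμ]
  · have h1 : N (v μ) ≤ M := hM (by simpa using ⟨μ, hμ, rfl⟩)
    have h2 := annihilate_mem_weightLE B n a (hN (v μ))
    rw [weightLE_of_neg (by push_cast at hn; omega)] at h2
    simpa using h2

/-- The Heisenberg field `a(z) = ∑ₙ a_(n) z⁻ⁿ⁻¹` on `V_L`, for `a ∈ 𝔥`. -/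
def heis (B : LinearMap.BilinForm ℤ L) (a : Cartan L) : VertexOperator ℂ (Space L) :=
  VertexOperator.of_coeff (fun m => heisMode B a (-m - 1)) (heisMode_bddBelow B a)

/-- The series `∑_{n ≥ 1} a_(-n) zⁿ / n` of operators on the Fock space. -/
def creationSeries (a : Cartan L) : PowerSeries (Module.End ℂ (Fock L)) :=
  PowerSeries.mk fun
    | 0 => 0
    | n + 1 => ((n + 1 : ℂ)⁻¹) • LinearMap.mulLeft ℂ (gen n a)

/-- The series `-∑_{n ≥ 1} a_(n) wⁿ / n` of operators on the Fock space, where `w = z⁻¹`. -/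
def annihilationSeries (B : LinearMap.BilinForm ℤ L) (a : Cartan L) :
    PowerSeries (Module.End ℂ (Fock L)) :=
  PowerSeries.mk fun
    | 0 => 0
    | n + 1 => -(((n + 1 : ℂ)⁻¹) • (annihilate B n a : Fock L →ₗ[ℂ] Fock L))

theorem annihilationSeries_pow_mem (B : LinearMap.BilinForm ℤ L) (a : Cartan L) (j : ℕ) :
    ∀ (m : ℕ) (N : ℤ) (s : Fock L), s ∈ weightLE L N →
      PowerSeries.coeff m (annihilationSeries B a ^ j) s ∈ weightLE L (N - m) := by
  induction j with
  | zero =>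
    intro m N s hs
    rw [pow_zero, PowerSeries.coeff_one]
    split_ifs with h
    · simpa [h] using hs
    · simp
  | succ j ih =>
    intro m N s hs
    rw [pow_succ, PowerSeries.coeff_mul, LinearMap.sum_apply]
    refine Submodule.sum_mem _ fun p hp => ?_
    have hp' : (p.1 : ℤ) + p.2 = m := by exact_mod_cast Finset.HasAntidiagonal.mem_antidiagonal.1 hp
    rw [Module.End.mul_apply]
    have h1 : PowerSeries.coeff p.2 (annihilationSeries B a) s ∈ weightLE L (N - p.2) := by
      rcases hp2 : p.2 with _ | n
      · simp [annihilationSeries]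
      · simp only [annihilationSeries, PowerSeries.coeff_mk, LinearMap.neg_apply,
          LinearMap.smul_apply]
        refine Submodule.neg_mem _ (Submodule.smul_mem _ _ ?_)
        exact_mod_cast annihilate_mem_weightLE B n a hs
    have h2 := ih p.1 _ _ h1
    rwa [show N - p.2 - p.1 = N - m by omega] at h2

theorem exp_annihilationSeries_eq_zero (B : LinearMap.BilinForm ℤ L) (a : Cartan L) {N : ℤ}
    {s : Fock L} (hs : s ∈ weightLE L N) {m : ℕ} (hm : N < m) :
    PowerSeries.coeff m (expSeries (annihilationSeries B a)) s = 0 := by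
  rw [expSeries, PowerSeries.coeff_mk, LinearMap.sum_apply]
  refine Finset.sum_eq_zero fun j _ => ?_
  have := annihilationSeries_pow_mem B a j m N s hs
  rw [weightLE_of_neg (by omega), Submodule.mem_bot] at this
  rw [LinearMap.smul_apply, this, smul_zero]

/-- The summands of the coefficient of `zʲ` in
`exp (∑_{n ≥ 1} a_(-n) zⁿ / n) exp (-∑_{n ≥ 1} a_(n) z⁻ⁿ / n)`. -/
def expTerm (B : LinearMap.BilinForm ℤ L) (a : Cartan L) (j : ℤ) (q : ℕ) :
    Module.End ℂ (Fock L) :=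
  if 0 ≤ j + q then
    PowerSeries.coeff (j + q).toNat (expSeries (creationSeries a)) *
      PowerSeries.coeff q (expSeries (annihilationSeries B a))
  else 0

theorem expTerm_finite (B : LinearMap.BilinForm ℤ L) (a : Cartan L) (j : ℤ) (s : Fock L) :
    (Function.support fun q => expTerm B a j q s).Finite := by
  obtain ⟨N, hN⟩ := exists_mem_weightLE s
  refine (Set.finite_Iic N.toNat).subset fun q hq => ?_
  rw [Function.mem_support] at hq
  by_contra hlt
  rw [Set.mem_Iic, not_le] at hlt
  apply hq
  unfold expTerm
  split_ifs
  · rw [Module.End.mul_apply, exp_annihilationSeries_eq_zero B a hN (by omega), map_zero]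
  · simp

/-- The coefficient of `zʲ` in
`exp (∑_{n ≥ 1} a_(-n) zⁿ / n) exp (-∑_{n ≥ 1} a_(n) z⁻ⁿ / n)`. -/
def expCoeff (B : LinearMap.BilinForm ℤ L) (a : Cartan L) (j : ℤ) : Module.End ℂ (Fock L) :=
  locSum (expTerm B a j) (expTerm_finite B a j)

theorem expCoeff_eq_zero (B : LinearMap.BilinForm ℤ L) (a : Cartan L) {N : ℤ} {s : Fock L}
    (hs : s ∈ weightLE L N) {j : ℤ} (hj : j < -N) : expCoeff B a j s = 0 := by
  rw [expCoeff, locSum_apply]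
  refine (finsum_congr fun q => ?_).trans finsum_zero
  unfold expTerm
  split_ifs
  · rw [Module.End.mul_apply, exp_annihilationSeries_eq_zero B a hs (by omega), map_zero]
  · simp

/-- The coefficient of `zᵐ` in
`e^ν(z) = e^ν z^{ν_(0)} exp (∑_{n ≥ 1} ν_(-n) zⁿ / n) exp (-∑_{n ≥ 1} ν_(n) z⁻ⁿ / n)`,
where `e^ν (e^μ ⊗ s) = ε(ν, μ) e^{ν + μ} ⊗ s` and `z^{ν_(0)} (e^μ ⊗ s) = z^{(ν|μ)} e^μ ⊗ s`. -/
def vertexCoeff (B : LinearMap.BilinForm ℤ L) (ε : Cocycle B) (ν : L) (m : ℤ) :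
    Module.End ℂ (Space L) :=
  Finsupp.lsum ℂ fun μ =>
    (((ε.val ν μ : ℤˣ) : ℤ) : ℂ) • Finsupp.lsingle (ν + μ) ∘ₗ expCoeff B (incl ν) (m - B ν μ)

theorem vertexCoeff_bddBelow (B : LinearMap.BilinForm ℤ L) (ε : Cocycle B) (ν : L) (v : Space L) :
    BddBelow (Function.support fun m : ℤ => vertexCoeff B ε ν m v) := by
  choose N hN using fun s : Fock L => exists_mem_weightLE s
  obtain ⟨M, hM⟩ := (v.support.image fun μ => B ν μ - N (v μ)).bddBelow
  refine ⟨M, fun m hm => ?_⟩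
  rw [Function.mem_support] at hm
  by_contra hlt
  apply hm
  simp only [vertexCoeff, Finsupp.lsum_apply]
  refine Finset.sum_eq_zero fun μ hμ => ?_
  have h1 : M ≤ B ν μ - N (v μ) := hM (Finset.mem_coe.2 (Finset.mem_image_of_mem _ hμ))
  simp [expCoeff_eq_zero B (incl ν) (hN (v μ)) (j := m - B ν μ) (by omega)]

/-- The vertex operator `e^ν(z)` on `V_L`, for `ν ∈ L`. -/
def vertexOp (B : LinearMap.BilinForm ℤ L) (ε : Cocycle B) (ν : L) : VertexOperator ℂ (Space L) :=
  VertexOperator.of_coeff (vertexCoeff B ε ν) (vertexCoeff_bddBelow B ε ν)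

end LatticeVertexAlgebra

end

/-!
The argument computes the commutators of the three fields and compares them with the affine algebra.

For commuting fields `A`, `B` and Heisenberg fields `a`, `c`, the commutator of `:aA:` and `:cB:`
consists of `:cAB:`, `:aAB:`, and second-order terms in `AB` and `(∂A) B` (`coeff_nop_coeff_nop`).
The vertex operators of an isotropic vector `δ` satisfy `e^δ(z) e^{-δ}(z) = 1` and
`∂e^δ(z) e^{-δ}(z) = δ(z)`, the Heisenberg field (`coeff_nop_vertexOp_neg`,
`coeff_nop_eulerDeriv_vertexOp_neg`). Both identities are checked on the vectors `e^μ ⊗ 1` and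
propagated by the creation operators (`eq_of_commute_creation`). Consequently, for `e = :α e^δ:`
and `f = :γ e^{-δ}:`,

* `[e_(m), f_(n)] = β'_(m+n) + m k' δ_{m,-n}` with `k' = (α|δ)(γ|δ) + (α|γ)` and
  `β' = k' δ - (α|δ) γ - (γ|δ) α` (`ncoeff_current_neg`);
* the `e_(n)` commute among themselves if and only if `(α|α) = (α|δ)²`, and likewise for `f`
  (`coeff_current_self`, `form_self_eq_of_comm`);
* `[b_(m), e_(n)] = (b|δ) e_(m+n) + m (b|α) e^δ_(m+n-1)` (`heisMode_ncoeff_current`).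

If the fields give an embedding, then `β = β'`, `k = k'`, and, since `e_(0) ≠ 0`, `(β|δ) = 2`. The
formula for `β'` turns the last equation into `(α|δ)(γ|δ) = -1`, so that the rescaling by
`λ = (α|δ)⁻¹` gives the normal form (`relations_of_isEmbedding`).

Conversely, the normal form implies all the bracket relations, hence a representation
(`exists_representation`). Its kernel is stable under brackets, and brackets with `h t⁰`, `e t⁰`,
`f t⁰` reduce the claim that it lies in `ℂ K` to the combinations of the `h tⁿ` and `K`
(`mem_span_K_of_eq_zero`). The `h tⁿ` act by independent operators modulo scalars, because
`[β_(n), δ_(-m)] = 2 n δ_{n,m}` and `β_(0)` is not scalar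
(`heisMode_linearIndependent_mod_scalars`).
-/

noncomputable section

/-! ### Normally ordered products and their coefficients -/

namespace FieldCalculus

open HVertexOperator (coeff)

variable {V : Type*} [AddCommGroup V] [Module ℂ V]

theorem finite_support_smul {ι : Type*} (c : ℂ) {f : ι → V} (hf : (Function.support f).Finite) :
    (Function.support fun i => c • f i).Finite :=
  hf.subset (Function.support_const_smul_subset c f)

theorem coeff_nop_apply (A B : VertexOperator ℂ V) (m : ℤ) (v : V) :
    coeff (nop A B) m v = ∑ᶠ i, nopTerm A B m i v := rfl

theorem nopTerm_apply_of_nonneg (A B : VertexOperator ℂ V) (m : ℤ) {i : ℤ} (hi : 0 ≤ i) (v : V) :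
    nopTerm A B m i v = coeff A i (coeff B (m - i) v) := by
  rw [nopTerm, if_pos hi, Module.End.mul_apply]

theorem nopTerm_apply_of_neg (A B : VertexOperator ℂ V) (m : ℤ) {i : ℤ} (hi : i < 0) (v : V) :
    nopTerm A B m i v = coeff B (m - i) (coeff A i v) := by
  rw [nopTerm, if_neg (not_le.2 hi), Module.End.mul_apply]

theorem nopTerm_apply_of_commute {A B : VertexOperator ℂ V}
    (h : ∀ i j v, coeff A i (coeff B j v) = coeff B j (coeff A i v)) (m i : ℤ) (v : V) :
    nopTerm A B m i v = coeff A i (coeff B (m - i) v) := by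
  rcases le_or_gt 0 i with hi | hi
  · exact nopTerm_apply_of_nonneg A B m hi v
  · rw [nopTerm_apply_of_neg A B m hi, h]

theorem coeff_nop_apply_of_commute {A B : VertexOperator ℂ V}
    (h : ∀ i j v, coeff A i (coeff B j v) = coeff B j (coeff A i v)) (m : ℤ) (v : V) :
    coeff (nop A B) m v = ∑ᶠ i, coeff A i (coeff B (m - i) v) :=
  finsum_congr fun i => nopTerm_apply_of_commute h m i v

/-- The convolution product of two commuting fields is a finite sum on every vector, also after
shifting the summation index. -/
theorem finite_support_convolution {A B : VertexOperator ℂ V}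
    (h : ∀ i j v, coeff A i (coeff B j v) = coeff B j (coeff A i v)) (m n : ℤ) (v : V) :
    (Function.support fun i => coeff A (m + i) (coeff B (n - i) v)).Finite := by
  obtain ⟨a, ha⟩ := exists_coeff_eq_zero A v
  obtain ⟨b, hb⟩ := exists_coeff_eq_zero B v
  refine (Set.finite_Icc (a - m) (n - b)).subset fun i hi => ?_
  rw [Function.mem_support] at hi
  by_contra hmem
  apply hi
  by_cases h1 : n - i < b
  · rw [hb _ h1, map_zero]
  · rw [h, ha, map_zero]
    by_contra h2
    exact hmem ⟨by omega, by omega⟩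

/-- The convolution of two commuting fields is their normally ordered product: the order of the
factors in each summand is immaterial. -/
theorem finsum_convolution {A B : VertexOperator ℂ V}
    (h : ∀ i j v, coeff A i (coeff B j v) = coeff B j (coeff A i v)) (m n : ℤ) (v : V) :
    ∑ᶠ i, coeff A (m + i) (coeff B (n - i) v) = coeff (nop A B) (m + n) v := by
  rw [coeff_nop_apply_of_commute h, ← finsum_comp_equiv (Equiv.addLeft m)
    (f := fun i => coeff A i (coeff B (m + n - i) v))]
  refine finsum_congr fun i => ?_
  simp only [Equiv.coe_addLeft]
  rw [show m + n - (m + i) = n - i by ring]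

/-- The field with modes `m A_m`, that is, `z ∂A(z)`. -/
def eulerDeriv (A : VertexOperator ℂ V) : VertexOperator ℂ V :=
  VertexOperator.of_coeff (fun m => (m : ℂ) • coeff A m) fun v => by
    obtain ⟨a, ha⟩ := exists_coeff_eq_zero A v
    refine ⟨a, fun m hm => ?_⟩
    rw [Function.mem_support] at hm
    by_contra hlt
    exact hm (by rw [LinearMap.smul_apply, ha m (not_le.1 hlt), smul_zero])

theorem coeff_eulerDeriv_apply (A : VertexOperator ℂ V) (m : ℤ) (v : V) :
    coeff (eulerDeriv A) m v = (m : ℂ) • coeff A m v := rfl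

theorem eulerDeriv_commute {A B : VertexOperator ℂ V}
    (h : ∀ i j v, coeff A i (coeff B j v) = coeff B j (coeff A i v)) (i j : ℤ) (v : V) :
    coeff (eulerDeriv A) i (coeff B j v) = coeff B j (coeff (eulerDeriv A) i v) := by
  rw [coeff_eulerDeriv_apply, coeff_eulerDeriv_apply, h, map_smul]

/-- Commutator of a field `A` with `:γB:`, when `A` commutes with `B` and
`[γ(z), A(w)] = φ δ(z - w) A(w)`. -/
theorem coeff_coeff_nop {γ A B : VertexOperator ℂ V} {φ : ℂ}
    (hγA : ∀ i m v, coeff γ i (coeff A m v) = coeff A m (coeff γ i v) + φ • coeff A (m + i + 1) v)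
    (hAB : ∀ i j v, coeff A i (coeff B j v) = coeff B j (coeff A i v)) (m M : ℤ) (v : V) :
    coeff A m (coeff (nop γ B) M v) =
      coeff (nop γ B) M (coeff A m v) - φ • coeff (nop A B) (m + M + 1) v := by
  have hterm : ∀ i, coeff A m (nopTerm γ B M i v) =
      nopTerm γ B M i (coeff A m v) - φ • coeff A (m + 1 + i) (coeff B (M - i) v) := by
    intro i
    rw [show m + 1 + i = m + i + 1 by ring]
    rcases le_or_gt 0 i with hi | hi
    · rw [nopTerm_apply_of_nonneg _ _ _ hi, nopTerm_apply_of_nonneg _ _ _ hi, ← hAB, hγA]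
      abel
    · rw [nopTerm_apply_of_neg _ _ _ hi, nopTerm_apply_of_neg _ _ _ hi, hAB, hγA, map_add, map_smul,
        hAB (m + i + 1)]
      abel
  rw [coeff_nop_apply, coeff_nop_apply, map_finsum _ (nopTerm_finite γ B M v), finsum_congr hterm,
    finsum_sub_distrib (nopTerm_finite γ B M _)
      (finite_support_smul φ (finite_support_convolution hAB _ _ v)),
    ← smul_finsum, finsum_convolution hAB, show m + 1 + M = m + M + 1 by ring]

/-- Commutator of a Heisenberg field `α` with `:γB:`, where `[α(z), γ(w)] = κ ∂_w δ(z - w)` and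
`[α(z), B(w)] = ψ δ(z - w) B(w)`. Only the summand with index `-i - 2` meets the central term of
`[α, γ]`. -/
theorem heis_coeff_nop {α γ B : VertexOperator ℂ V} {ψ κ : ℂ}
    (hαγ : ∀ i j v, coeff α i (coeff γ j v) =
      coeff γ j (coeff α i v) - (if i + j + 2 = 0 then ((i : ℂ) + 1) * κ else 0) • v)
    (hαB : ∀ i m v, coeff α i (coeff B m v) = coeff B m (coeff α i v) + ψ • coeff B (m + i + 1) v)
    (i M : ℤ) (v : V) :
    coeff α i (coeff (nop γ B) M v) =
      coeff (nop γ B) M (coeff α i v) + ψ • coeff (nop γ B) (M + i + 1) v -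
        (((i : ℂ) + 1) * κ) • coeff B (M + i + 2) v := by
  have hterm : ∀ j, coeff α i (nopTerm γ B M j v) =
      nopTerm γ B M j (coeff α i v) + ψ • nopTerm γ B (M + i + 1) j v -
        (if i + j + 2 = 0 then ((i : ℂ) + 1) * κ else 0) • coeff B (M - j) v := by
    intro j
    rcases le_or_gt 0 j with hj | hj
    · simp only [nopTerm_apply_of_nonneg _ _ _ hj]
      rw [hαγ, hαB, map_add, map_smul, show M - j + i + 1 = M + i + 1 - j by ring]
    · simp only [nopTerm_apply_of_neg _ _ _ hj]
      rw [hαB, hαγ, map_sub, map_smul, show M - j + i + 1 = M + i + 1 - j by ring]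
      abel
  have hsupp : (Function.support fun j =>
      (if i + j + 2 = 0 then ((i : ℂ) + 1) * κ else 0) • coeff B (M - j) v).Finite := by
    refine (Set.finite_singleton (-i - 2)).subset fun j hj => ?_
    by_contra h
    rw [Function.mem_support, if_neg (fun h' => h (by simp; omega)), zero_smul] at hj
    exact hj rfl
  have hψ : (Function.support fun j => ψ • nopTerm γ B (M + i + 1) j v).Finite :=
    finite_support_smul ψ (nopTerm_finite γ B _ v)
  rw [coeff_nop_apply, coeff_nop_apply, coeff_nop_apply, map_finsum _ (nopTerm_finite γ B M v),
    finsum_congr hterm, finsum_sub_distrib (((nopTerm_finite γ B M _).union hψ).subset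
      (Function.support_add _ _)) hsupp,
    finsum_add_distrib (nopTerm_finite γ B M _) hψ, ← smul_finsum,
    finsum_eq_single (fun j => (if i + j + 2 = 0 then ((i : ℂ) + 1) * κ else 0) • coeff B (M - j) v)
      (-i - 2) fun j hj => by rw [if_neg (by omega), zero_smul],
    if_pos (by ring), show M - (-i - 2) = M + i + 2 by ring]

/-- The indices `j` that the shift by `l + 1` moves from the negative to the nonnegative half-line,
minus those that it moves back, are `l + 1` in number. This is where the derivative in the commutator
formula comes from. -/
theorem finsum_crossing (l : ℤ) :
    ∑ᶠ j : ℤ, ((if 0 ≤ l + j + 1 ∧ j < 0 then 1 else 0) -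
      (if l + j + 1 < 0 ∧ 0 ≤ j then 1 else 0) : ℂ) = l + 1 := by
  rcases le_or_gt (-1) l with hl | hl
  · rw [finsum_eq_sum_of_support_subset (s := Finset.Ico (-l - 1) 0)]
    · rw [Finset.sum_congr rfl (g := fun _ => (1 : ℂ))]
      · obtain ⟨n, hn⟩ := Int.eq_ofNat_of_zero_le (show 0 ≤ l + 1 by omega)
        obtain rfl : l = n - 1 := by omega
        simp
      · intro j hj
        rw [Finset.mem_Ico] at hj
        rw [if_pos (by omega), if_neg (by omega), sub_zero]
    · intro j hj
      by_contra h
      rw [Finset.mem_coe, Finset.mem_Ico] at h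
      exact hj (by dsimp only; rw [if_neg (by omega), if_neg (by omega), sub_zero])
  · rw [finsum_eq_sum_of_support_subset (s := Finset.Ico 0 (-l - 1))]
    · rw [Finset.sum_congr rfl (g := fun _ => (-1 : ℂ))]
      · obtain ⟨n, hn⟩ := Int.eq_ofNat_of_zero_le (show 0 ≤ -l - 1 by omega)
        obtain rfl : l = -n - 1 := by omega
        simp
      · intro j hj
        rw [Finset.mem_Ico] at hj
        rw [if_neg (by omega), if_pos (by omega), zero_sub]
    · intro j hj
      by_contra h
      rw [Finset.mem_coe, Finset.mem_Ico] at h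
      exact hj (by dsimp only; rw [if_neg (by omega), if_neg (by omega), sub_zero])

end FieldCalculus

/-! ### Commutators of normally ordered products -/

namespace FieldCalculus

open HVertexOperator (coeff)

variable {V : Type*} [AddCommGroup V] [Module ℂ V]

/-- The summands, indexed by `(i, j)`, of the ordered product of `A` with `:γB:` on the vector `v`:
`i` labels the pair of modes `A_{N - i}`, `(:γB:)_{M + 1 + i}`, with `A` acting first for `i ≥ 0`, and
`j` labels the summand of `(:γB:)_{M + 1 + i}` that contains `γ_j`. -/
def tripleTerm (γ A B : VertexOperator ℂ V) (N M : ℤ) (v : V) (p : ℤ × ℤ) : V :=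
  if 0 ≤ p.1 then nopTerm γ B (M + 1 + p.1) p.2 (coeff A (N - p.1) v)
  else coeff A (N - p.1) (nopTerm γ B (M + 1 + p.1) p.2 v)

theorem tripleTerm_finite {γ A B : VertexOperator ℂ V} {φ ψ : ℂ}
    (hγA : ∀ i m v, coeff γ i (coeff A m v) = coeff A m (coeff γ i v) + φ • coeff A (m + i + 1) v)
    (hγB : ∀ i m v, coeff γ i (coeff B m v) = coeff B m (coeff γ i v) + ψ • coeff B (m + i + 1) v)
    (hAB : ∀ i j v, coeff A i (coeff B j v) = coeff B j (coeff A i v)) (N M : ℤ) (v : V) :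
    (Function.support (tripleTerm γ A B N M v)).Finite := by
  obtain ⟨a, ha⟩ := exists_coeff_eq_zero A v
  obtain ⟨b, hb⟩ := exists_coeff_eq_zero B v
  obtain ⟨c, hc⟩ := exists_coeff_eq_zero γ v
  -- Outside this box some mode of `A`, `B` or `γ` can be moved next to `v`, with commutator terms that
  -- vanish as well, and its index is below the bound `a`, `b` or `c` under which it kills `v`.
  refine ((Set.finite_Icc (min 0 (min (b - M - 1 + c) (b - M - 1))) (max (N - a) 0)).prod
    (Set.finite_Icc (min 0 (min c (a - N - 1)))
      (max 0 (M + 1 + max (N - a) 0 - b)))).subset fun ⟨i, j⟩ hp => ?_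
  rw [Function.mem_support] at hp
  rw [Set.mem_prod, Set.mem_Icc, Set.mem_Icc]
  dsimp only
  by_contra hmem
  apply hp
  unfold tripleTerm
  dsimp only
  rcases le_or_gt 0 i with hi | hi
  · rw [if_pos hi]
    by_cases h1 : N - i < a
    · rw [ha _ h1, map_zero]
    rcases le_or_gt 0 j with hj | hj
    · rw [nopTerm_apply_of_nonneg _ _ _ hj, ← hAB, hb (M + 1 + i - j) (by omega), map_zero,
        map_zero]
    · rw [nopTerm_apply_of_neg _ _ _ hj, hγA, hc j (by omega), ha (N - i + j + 1) (by omega)]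
      simp
  · rw [if_neg (not_le.2 hi)]
    rcases le_or_gt 0 j with hj | hj
    · rw [nopTerm_apply_of_nonneg _ _ _ hj, hb (M + 1 + i - j) (by omega), map_zero, map_zero]
    · rw [nopTerm_apply_of_neg _ _ _ hj]
      by_cases h1 : j < c
      · rw [hc j h1, map_zero, map_zero]
      · have h2 := hγB j (M + 1 + i - j) v
        rw [hb (M + 1 + i - j) (by omega), hb (M + 1 + i - j + j + 1) (by omega), map_zero,
          smul_zero, add_zero] at h2
        rw [← h2, map_zero]

/-- Quasi-associativity of the normally ordered product: reordering the product of `A` with `:γB:`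
into `:γ(AB):` costs a derivative term. -/
theorem finsum_ordered_product {γ A B : VertexOperator ℂ V} {φ ψ : ℂ}
    (hγA : ∀ i m v, coeff γ i (coeff A m v) = coeff A m (coeff γ i v) + φ • coeff A (m + i + 1) v)
    (hγB : ∀ i m v, coeff γ i (coeff B m v) = coeff B m (coeff γ i v) + ψ • coeff B (m + i + 1) v)
    (hAB : ∀ i j v, coeff A i (coeff B j v) = coeff B j (coeff A i v)) (N M : ℤ) (v : V) :
    ∑ᶠ i : ℤ, (if 0 ≤ i then coeff (nop γ B) (M + 1 + i) (coeff A (N - i) v)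
      else coeff A (N - i) (coeff (nop γ B) (M + 1 + i) v)) =
    coeff (nop γ (nop A B)) (N + M + 1) v +
      φ • ∑ᶠ l : ℤ, ((l : ℂ) + 1) • coeff A (N - l) (coeff B (M + 2 + l) v) := by
  have hfin := tripleTerm_finite hγA hγB hAB N M v
  -- `G'` is the summand with `γ_j` outside `A` and `B` for `j ≥ 0` and inside them for `j < 0`. To bring
  -- a summand of `A :γB:` to this form, `γ_j` has to cross `A` exactly if one of `i`, `j` is negative
  -- and the other is not; `w` is the sign of the resulting commutator and `X` its operator part.
  set w : ℤ → ℤ → ℂ := fun i j => (if 0 ≤ i ∧ j < 0 then 1 else 0) -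
    (if i < 0 ∧ 0 ≤ j then 1 else 0) with hw
  set X : ℤ × ℤ → V := fun p =>
    w p.1 p.2 • coeff A (N - (p.1 - p.2 - 1)) (coeff B (M + 2 + (p.1 - p.2 - 1)) v) with hX
  set G' : ℤ × ℤ → V := fun p =>
    if 0 ≤ p.2 then coeff γ p.2 (coeff A (N - p.1) (coeff B (M + 1 + p.1 - p.2) v))
    else coeff A (N - p.1) (coeff B (M + 1 + p.1 - p.2) (coeff γ p.2 v)) with hG'
  have hXfin : (Function.support X).Finite := by
    obtain ⟨a, ha⟩ := exists_coeff_eq_zero A v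
    obtain ⟨b, hb⟩ := exists_coeff_eq_zero B v
    refine ((Set.finite_Icc (min 0 (b - M - 1)) (max 0 (N - a))).prod
      (Set.finite_Icc (min 0 (a - N - 1)) (max 0 (M + 1 - b)))).subset fun ⟨i, j⟩ hp => ?_
    rw [Function.mem_support] at hp
    rw [Set.mem_prod, Set.mem_Icc, Set.mem_Icc]
    dsimp only
    by_contra hmem
    apply hp
    rw [hX, hw]
    dsimp only
    by_cases h1 : M + 2 + (i - j - 1) < b
    · rw [hb _ h1, map_zero, smul_zero]
    by_cases h2 : N - (i - j - 1) < a
    · rw [hAB, ha _ h2, map_zero, smul_zero]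
    rw [if_neg (by omega), if_neg (by omega), sub_zero, zero_smul]
  have hterm : ∀ p, tripleTerm γ A B N M v p = G' p + φ • X p := by
    rintro ⟨i, j⟩
    simp only [tripleTerm, hG', hX, hw]
    rcases le_or_gt 0 i with hi | hi <;> rcases le_or_gt 0 j with hj | hj
    · rw [if_pos hi, if_pos hj, if_neg (by omega), if_neg (by omega),
        nopTerm_apply_of_nonneg _ _ _ hj, hAB]
      simp
    · rw [if_pos hi, if_neg (not_le.2 hj), if_pos ⟨hi, hj⟩, if_neg (by omega),
        nopTerm_apply_of_neg _ _ _ hj, hγA, hAB, map_add, map_smul, hAB,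
        show N - i + j + 1 = N - (i - j - 1) by ring,
        show M + 1 + i - j = M + 2 + (i - j - 1) by ring]
      simp
    · rw [if_neg (not_le.2 hi), if_pos hj, if_neg (by omega), if_pos ⟨hi, hj⟩,
        nopTerm_apply_of_nonneg _ _ _ hj, hγA,
        show N - i + j + 1 = N - (i - j - 1) by ring,
        show M + 1 + i - j = M + 2 + (i - j - 1) by ring]
      simp
    · rw [if_neg (not_le.2 hi), if_neg (not_le.2 hj), if_neg (by omega), if_neg (by omega),
        nopTerm_apply_of_neg _ _ _ hj]
      simp
  have hG'fin : (Function.support G').Finite := by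
    have : G' = fun p => tripleTerm γ A B N M v p - φ • X p := by
      funext p
      rw [hterm, add_sub_cancel_right]
    rw [this]
    exact (hfin.union (finite_support_smul φ hXfin)).subset (Function.support_sub _ _)
  have h1 : ∑ᶠ p, tripleTerm γ A B N M v p =
      ∑ᶠ i : ℤ, (if 0 ≤ i then coeff (nop γ B) (M + 1 + i) (coeff A (N - i) v)
        else coeff A (N - i) (coeff (nop γ B) (M + 1 + i) v)) := by
    rw [finsum_curry _ hfin]
    refine finsum_congr fun i => ?_
    unfold tripleTerm
    dsimp only
    split_ifs with hi
    · rw [coeff_nop_apply]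
    · rw [coeff_nop_apply, map_finsum _ (nopTerm_finite γ B _ v)]
  -- Summed over `i` first, the modes of `A` and `B` combine to those of `:AB:`.
  have h2 : ∑ᶠ p, G' p = coeff (nop γ (nop A B)) (N + M + 1) v := by
    rw [← finsum_comp_equiv (Equiv.prodComm ℤ ℤ), finsum_curry, coeff_nop_apply]
    · refine finsum_congr fun j => ?_
      simp only [hG', Equiv.prodComm_apply, Prod.swap_prod_mk]
      have hshift : ∀ u, ∑ᶠ i : ℤ, coeff A (N - i) (coeff B (M + 1 + i - j) u) =
          coeff (nop A B) (N + M + 1 - j) u := by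
        intro u
        rw [show N + M + 1 - j = N + (M + 1 - j) by ring, ← finsum_convolution hAB,
          ← finsum_comp_equiv (Equiv.neg ℤ)]
        refine finsum_congr fun i => ?_
        rw [Equiv.neg_apply, sub_neg_eq_add, show M + 1 + -i - j = M + 1 - j - i by ring]
      rcases le_or_gt 0 j with hj | hj
      · simp only [if_pos hj]
        rw [nopTerm_apply_of_nonneg _ _ _ hj, ← hshift, map_finsum]
        have h3 := finite_support_convolution hAB N (M + 1 - j) v
        refine (h3.preimage (f := fun i : ℤ => -i) (by simp)).subset fun i hi => ?_
        rw [Set.mem_preimage, Function.mem_support, ← sub_eq_add_neg,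
          show M + 1 - j - -i = M + 1 + i - j by ring]
        exact hi
      · simp only [if_neg (not_le.2 hj)]
        rw [nopTerm_apply_of_neg _ _ _ hj, ← hshift]
    · exact hG'fin.preimage (Equiv.prodComm ℤ ℤ).injective.injOn
  -- The operator part of `X` depends on `l = i - j - 1` only; for fixed `l` the signs add up to `l + 1`.
  have h3 : ∑ᶠ p, X p =
      ∑ᶠ l : ℤ, ((l : ℂ) + 1) • coeff A (N - l) (coeff B (M + 2 + l) v) := by
    let e : ℤ × ℤ ≃ ℤ × ℤ :=
      { toFun := fun p => (p.1 + p.2 + 1, p.2)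
        invFun := fun p => (p.1 - p.2 - 1, p.2)
        left_inv := fun p => Prod.ext (by dsimp only; ring) rfl
        right_inv := fun p => Prod.ext (by dsimp only; ring) rfl }
    rw [← finsum_comp_equiv e, finsum_curry]
    · refine finsum_congr fun l => ?_
      rw [← finsum_crossing l, finsum_smul]
      refine finsum_congr fun j => ?_
      simp only [hX, hw, e, Equiv.coe_fn_mk]
      rw [show l + j + 1 - j - 1 = l by ring]
    · exact hXfin.preimage e.injective.injOn
  rw [← h1, finsum_congr hterm, finsum_add_distrib hG'fin (finite_support_smul φ hXfin), h2,
    ← smul_finsum, h3]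

/-- The commutator of the fields `:αA:` and `:γB:`, for commuting fields `A` and `B` with
`[α(z), B(w)] = ψ δ(z - w) B(w)`, `[γ(z), A(w)] = φ δ(z - w) A(w)`, `[γ(z), B(w)] = ψ' δ(z - w) B(w)`
and `[α(z), γ(w)] = κ ∂_w δ(z - w)`. The first-order terms are `ψ :γAB: - φ :αAB:`; the second-order
ones involve `AB` and `(z ∂A) B` with the factor `ψ φ - κ`. -/
theorem coeff_nop_coeff_nop {α γ A B : VertexOperator ℂ V} {φ ψ ψ' κ : ℂ}
    (hαγ : ∀ i j v, coeff α i (coeff γ j v) =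
      coeff γ j (coeff α i v) - (if i + j + 2 = 0 then ((i : ℂ) + 1) * κ else 0) • v)
    (hαB : ∀ i m v, coeff α i (coeff B m v) = coeff B m (coeff α i v) + ψ • coeff B (m + i + 1) v)
    (hγA : ∀ i m v, coeff γ i (coeff A m v) = coeff A m (coeff γ i v) + φ • coeff A (m + i + 1) v)
    (hγB : ∀ i m v, coeff γ i (coeff B m v) = coeff B m (coeff γ i v) + ψ' • coeff B (m + i + 1) v)
    (hAB : ∀ i j v, coeff A i (coeff B j v) = coeff B j (coeff A i v)) (N M : ℤ) (v : V) :
    coeff (nop α A) N (coeff (nop γ B) M v) = coeff (nop γ B) M (coeff (nop α A) N v) +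
      ψ • coeff (nop γ (nop A B)) (N + M + 1) v - φ • coeff (nop α (nop A B)) (N + M + 1) v +
      (ψ * φ - κ) • (((N : ℂ) + 1) • coeff (nop A B) (N + M + 2) v -
        coeff (nop (eulerDeriv A) B) (N + M + 2) v) := by
  -- With `i = N - l` the weight `l + 1` becomes `(N + 1) - i`, and `i A_i` is a mode of `z ∂A`.
  have hD : ∑ᶠ l : ℤ, ((l : ℂ) + 1) • coeff A (N - l) (coeff B (M + 2 + l) v) =
      ((N : ℂ) + 1) • coeff (nop A B) (N + M + 2) v -
        coeff (nop (eulerDeriv A) B) (N + M + 2) v := by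
    rw [coeff_nop_apply_of_commute hAB, coeff_nop_apply_of_commute (eulerDeriv_commute hAB),
      smul_finsum, ← finsum_sub_distrib, ← finsum_comp_equiv (Equiv.subLeft N)]
    · refine finsum_congr fun i => ?_
      rw [Equiv.subLeft_apply, coeff_eulerDeriv_apply, ← sub_smul, sub_sub_cancel,
        show M + 2 + (N - i) = N + M + 2 - i by ring]
      push_cast
      congr 1
      ring
    · have h := finite_support_convolution hAB 0 (N + M + 2) v
      simp only [zero_add] at h
      exact finite_support_smul _ h
    · have h := finite_support_convolution (eulerDeriv_commute hAB) 0 (N + M + 2) v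
      simp only [zero_add] at h
      exact h
  have hDfin : (Function.support fun l : ℤ =>
      ((l : ℂ) + 1) • coeff A (N - l) (coeff B (M + 2 + l) v)).Finite := by
    refine ((finite_support_convolution hAB N (M + 2) v).preimage
      (f := fun i : ℤ => -i) (by simp)).subset fun i hi => ?_
    rw [Set.mem_preimage, Function.mem_support, ← sub_eq_add_neg, sub_neg_eq_add]
    exact fun h => hi (by dsimp only; rw [h, smul_zero])
  have hSfin : (Function.support fun i : ℤ =>
      if 0 ≤ i then coeff (nop γ B) (M + 1 + i) (coeff A (N - i) v)
      else coeff A (N - i) (coeff (nop γ B) (M + 1 + i) v)).Finite := by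
    obtain ⟨a, ha⟩ := exists_coeff_eq_zero A v
    obtain ⟨f, hf⟩ := exists_coeff_eq_zero (nop γ B) v
    refine (Set.finite_Icc (min 0 (f - M - 1)) (max 0 (N - a))).subset fun i hi => ?_
    rw [Function.mem_support] at hi
    by_contra hmem
    rw [Set.mem_Icc] at hmem
    apply hi
    split_ifs with h0
    · rw [ha _ (by omega), map_zero]
    · rw [hf _ (by omega), map_zero]
  have hterm : ∀ i, nopTerm α A N i (coeff (nop γ B) M v) =
      coeff (nop γ B) M (nopTerm α A N i v) +
      ψ • (if 0 ≤ i then coeff (nop γ B) (M + 1 + i) (coeff A (N - i) v)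
        else coeff A (N - i) (coeff (nop γ B) (M + 1 + i) v)) -
      φ • nopTerm α (nop A B) (N + M + 1) i v -
      κ • (((i : ℂ) + 1) • coeff A (N - i) (coeff B (M + 2 + i) v)) := by
    intro i
    rcases le_or_gt 0 i with hi | hi
    · rw [nopTerm_apply_of_nonneg _ _ _ hi, nopTerm_apply_of_nonneg _ _ _ hi,
        nopTerm_apply_of_nonneg _ _ _ hi, if_pos hi, coeff_coeff_nop hγA hAB, map_sub, map_smul,
        heis_coeff_nop hαγ hαB, show N - i + M + 1 = N + M + 1 - i by ring,
        show M + i + 1 = M + 1 + i by ring, show M + i + 2 = M + 2 + i by ring, hAB, smul_smul,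
        mul_comm κ]
      abel
    · rw [nopTerm_apply_of_neg _ _ _ hi, nopTerm_apply_of_neg _ _ _ hi,
        nopTerm_apply_of_neg _ _ _ hi, if_neg (not_le.2 hi), heis_coeff_nop hαγ hαB, map_sub,
        map_add, map_smul, map_smul, coeff_coeff_nop hγA hAB,
        show N - i + M + 1 = N + M + 1 - i by ring,
        show M + i + 1 = M + 1 + i by ring, show M + i + 2 = M + 2 + i by ring, smul_smul,
        mul_comm κ]
      abel
  have hF : (Function.support fun i => coeff (nop γ B) M (nopTerm α A N i v)).Finite :=
    (nopTerm_finite α A N v).subset fun i hi h => hi (by dsimp only at h ⊢; rw [h, map_zero])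
  have hS' := finite_support_smul ψ hSfin
  have hT' := finite_support_smul φ (nopTerm_finite α (nop A B) (N + M + 1) v)
  have hFS := (hF.union hS').subset (Function.support_add _ _)
  have hFST := (hFS.union hT').subset (Function.support_sub _ _)
  rw [coeff_nop_apply α A, finsum_congr hterm, finsum_sub_distrib hFST (finite_support_smul κ hDfin),
    finsum_sub_distrib hFS hT', finsum_add_distrib hF hS', ← smul_finsum, ← smul_finsum,
    ← smul_finsum, ← map_finsum _ (nopTerm_finite α A N v), finsum_ordered_product hγA hγB hAB, hD,
    ← coeff_nop_apply, ← coeff_nop_apply, sub_smul, mul_smul]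
  module

end FieldCalculus

/-! ### Exponentials of power series -/

namespace FieldCalculus

open PowerSeries in
theorem coeff_pow_eq_zero {A : Type*} [Ring A] {x : PowerSeries A} (hx : coeff 0 x = 0) {m j : ℕ}
    (h : m < j) : coeff m (x ^ j) = 0 := by
  induction j generalizing m with
  | zero => omega
  | succ j ih =>
    rw [pow_succ, coeff_mul]
    refine Finset.sum_eq_zero fun p hp => ?_
    rw [Finset.HasAntidiagonal.mem_antidiagonal] at hp
    rcases Nat.eq_zero_or_pos p.2 with h2 | h2
    · rw [h2, hx, mul_zero]
    · rw [ih (by omega), zero_mul]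

section Exponential

open PowerSeries

variable {A : Type*} [Ring A] [Algebra ℂ A]

/-- The truncation point of the exponential sum may be any `K > m`, not only `m + 1`. -/
theorem coeff_expSeries {x : PowerSeries A} (hx : coeff 0 x = 0) {m K : ℕ} (h : m < K) :
    coeff m (expSeries x) =
      ∑ j ∈ Finset.range K, ((j.factorial : ℂ)⁻¹) • coeff m (x ^ j) := by
  rw [expSeries, coeff_mk]
  refine Finset.sum_subset (Finset.range_mono h) fun j _ hj => ?_
  rw [coeff_pow_eq_zero hx (by simpa using hj), smul_zero]

theorem coeff_zero_expSeries (x : PowerSeries A) : coeff 0 (expSeries x) = 1 := by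
  simp [expSeries]

theorem coeff_expSeries_map {A' : Type*} [Ring A'] [Algebra ℂ A'] (g : A →ₐ[ℂ] A')
    (x : PowerSeries A) (m : ℕ) :
    coeff m (expSeries (PowerSeries.map (g : A →+* A') x)) = g (coeff m (expSeries x)) := by
  simp only [expSeries, coeff_mk, map_sum, map_smul, ← map_pow, coeff_map, RingHom.coe_coe]

/-- The coefficients of a power series, extended by zero to negative exponents. -/
def intCoeff {R : Type*} [Semiring R] (x : PowerSeries R) (j : ℤ) : R :=
  if 0 ≤ j then coeff j.toNat x else 0

theorem intCoeff_natCast {R : Type*} [Semiring R] (x : PowerSeries R) (j : ℕ) :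
    intCoeff x j = coeff j x := by
  simp [intCoeff]

theorem intCoeff_of_neg {R : Type*} [Semiring R] (x : PowerSeries R) {j : ℤ} (hj : j < 0) :
    intCoeff x j = 0 := by
  rw [intCoeff, if_neg (by omega)]

theorem intCoeff_one {R : Type*} [Semiring R] (j : ℤ) :
    intCoeff (1 : PowerSeries R) j = if j = 0 then 1 else 0 := by
  rcases lt_or_ge j 0 with hj | hj
  · rw [intCoeff_of_neg _ hj, if_neg (by omega)]
  · obtain ⟨n, rfl⟩ := Int.eq_ofNat_of_zero_le hj
    rw [intCoeff_natCast, coeff_one]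
    simp

theorem intCoeff_X_pow_mul {R : Type*} [Semiring R] (x : PowerSeries R) (p : ℕ) (j : ℤ) :
    intCoeff (X ^ p * x) j = intCoeff x (j - p) := by
  rcases lt_or_ge j 0 with hj | hj
  · rw [intCoeff_of_neg _ hj, intCoeff_of_neg _ (by omega)]
  · obtain ⟨n, rfl⟩ := Int.eq_ofNat_of_zero_le hj
    rw [intCoeff_natCast, coeff_X_pow_mul']
    split_ifs with h
    · rw [← Nat.cast_sub h, intCoeff_natCast]
    · rw [intCoeff_of_neg _ (by omega)]

/-- If the commutator of `D` with the coefficients of `x` is `c Xᵖ`, then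
`[D, exp x] = c Xᵖ exp x`. -/
theorem mul_intCoeff_expSeries {x : PowerSeries A} (hx : coeff 0 x = 0) {D : A} {c : ℂ} {p : ℕ}
    (hp : 0 < p)
    (hD : ∀ m, D * coeff m x = coeff m x * D + if m = p then algebraMap ℂ A c else 0) (j : ℤ) :
    D * intCoeff (expSeries x) j =
      intCoeff (expSeries x) j * D + c • intCoeff (expSeries x) (j - p) := by
  have h1 : C D * x = x * C D + c • X ^ p := by
    ext m
    rw [coeff_C_mul, hD, map_add, coeff_mul_C, coeff_smul, coeff_X_pow]
    split_ifs <;> simp [Algebra.algebraMap_eq_smul_one]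
  -- The commutator is central, so `D` acts on powers of `x` by the Leibniz rule.
  have h2 : ∀ r : ℕ, C D * x ^ (r + 1) =
      x ^ (r + 1) * C D + ((r + 1 : ℂ) * c) • (X ^ p * x ^ r) := by
    intro r
    induction r with
    | zero => simpa using h1
    | succ r ih =>
      rw [pow_succ x (r + 1), ← mul_assoc, ih, add_mul, mul_assoc (x ^ (r + 1)), h1, mul_add,
        mul_assoc, smul_mul_assoc, mul_assoc (X ^ p), ← pow_succ, mul_smul_comm,
        (commute_X_pow (x ^ (r + 1)) p).eq, add_assoc, ← add_smul]
      congr 2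
      push_cast
      ring
  rcases lt_or_ge j 0 with hj | hj
  · rw [intCoeff_of_neg _ hj, intCoeff_of_neg _ (by omega)]
    simp
  obtain ⟨m, rfl⟩ := Int.eq_ofNat_of_zero_le hj
  rw [intCoeff_natCast, coeff_expSeries hx (show m < m + 1 + 1 by omega), Finset.mul_sum,
    Finset.sum_mul, Finset.sum_range_succ', Finset.sum_range_succ' _ (m + 1)]
  have h3 : ∀ r, D * ((((r + 1).factorial : ℂ)⁻¹) • coeff m (x ^ (r + 1))) =
      ((((r + 1).factorial : ℂ)⁻¹) • coeff m (x ^ (r + 1))) * D +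
        c • ((r.factorial : ℂ)⁻¹ • intCoeff (x ^ r) (m - p)) := by
    intro r
    have h4 := congrArg (coeff m) (h2 r)
    rw [coeff_C_mul, map_add, coeff_mul_C, coeff_smul, ← intCoeff_natCast (X ^ p * x ^ r),
      intCoeff_X_pow_mul] at h4
    rw [mul_smul_comm, h4, smul_mul_assoc, smul_add, smul_smul, smul_smul]
    congr 2
    have h5 : (r.factorial : ℂ) ≠ 0 := by exact_mod_cast r.factorial_ne_zero
    have h6 : (r + 1 : ℂ) ≠ 0 := by exact_mod_cast r.succ_ne_zero
    rw [Nat.factorial_succ]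
    push_cast
    field_simp
  have h7 : ∑ r ∈ Finset.range (m + 1), (r.factorial : ℂ)⁻¹ • intCoeff (x ^ r) (m - p) =
      intCoeff (expSeries x) (m - p) := by
    rcases lt_or_ge m p with hmp | hmp
    · rw [intCoeff_of_neg _ (by omega)]
      exact Finset.sum_eq_zero fun r _ => by rw [intCoeff_of_neg _ (by omega), smul_zero]
    · simp only [← Nat.cast_sub hmp, intCoeff_natCast]
      rw [coeff_expSeries hx (show m - p < m + 1 by omega)]
  rw [Finset.sum_congr rfl fun r _ => h3 r, Finset.sum_add_distrib, ← Finset.smul_sum, h7]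
  have h8 : D * ((((0 : ℕ).factorial : ℂ)⁻¹) • coeff m (x ^ 0)) =
      ((((0 : ℕ).factorial : ℂ)⁻¹) • coeff m (x ^ 0)) * D := by
    rw [pow_zero, coeff_one]
    split_ifs <;> simp
  rw [h8]
  abel

end Exponential

section CommExponential

open PowerSeries

theorem derivative_expSeries {R : Type*} [CommRing R] [Algebra ℂ R]
    {x : PowerSeries R} (hx : coeff 0 x = 0) :
    d⁄dX R (expSeries x) = expSeries x * d⁄dX R x := by
  ext n
  rw [coeff_derivative, coeff_expSeries hx (Nat.lt_succ_self (n + 1)), Finset.sum_range_succ',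
    add_mul, Finset.sum_mul, pow_zero, coeff_one, if_neg (by omega), smul_zero, zero_mul, add_zero]
  have h1 : ∀ r, ((((r + 1).factorial : ℂ)⁻¹) • coeff (n + 1) (x ^ (r + 1))) * ((n : R) + 1) =
      coeff n (((r.factorial : ℂ)⁻¹ • x ^ r) * d⁄dX R x) := by
    intro r
    rw [smul_mul_assoc, ← coeff_derivative, derivative_pow, smul_mul_assoc, coeff_smul,
      Nat.factorial_succ, Nat.add_sub_cancel, mul_assoc, ← nsmul_eq_mul, map_nsmul,
      ← Nat.cast_smul_eq_nsmul ℂ, smul_smul]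
    congr 1
    have h6 : (r + 1 : ℂ) ≠ 0 := by exact_mod_cast r.succ_ne_zero
    push_cast
    field_simp
  rw [Finset.sum_congr rfl fun r _ => h1 r, ← map_sum, ← Finset.sum_mul, coeff_mul, coeff_mul]
  refine Finset.sum_congr rfl fun p hp => ?_
  rw [Finset.HasAntidiagonal.mem_antidiagonal] at hp
  rw [map_sum, coeff_expSeries hx (show p.1 < n + 1 by omega)]
  simp only [coeff_smul]

theorem expSeries_mul_expSeries_neg {R : Type*} [CommRing R] [Algebra ℂ R]
    {x : PowerSeries R} (hx : coeff 0 x = 0) :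
    expSeries x * expSeries (-x) = 1 := by
  -- The product has derivative zero and constant term one; over a torsion-free ring this determines it.
  let _ : Module ℚ R := Module.compHom R (algebraMap ℚ ℂ)
  have hR : IsAddTorsionFree R := IsAddTorsionFree.of_module_rat R
  refine derivative.ext ?_ ?_
  · have hx' : coeff 0 (-x) = 0 := by rw [map_neg, hx, neg_zero]
    rw [Derivation.leibniz, derivative_expSeries hx, derivative_expSeries hx', map_neg,
      derivative_one, smul_eq_mul, smul_eq_mul]
    ring
  · rw [map_mul, ← coeff_zero_eq_constantCoeff_apply, ← coeff_zero_eq_constantCoeff_apply,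
      coeff_zero_expSeries, coeff_zero_expSeries, mul_one, map_one]

theorem intCoeff_X_mul_derivative {R : Type*} [CommRing R] (x : PowerSeries R) (j : ℤ) :
    intCoeff (X * d⁄dX R x) j = (j : R) * intCoeff x j := by
  rcases lt_or_ge j 0 with hj | hj
  · rw [intCoeff_of_neg _ hj, intCoeff_of_neg _ hj, mul_zero]
  · obtain ⟨n, rfl⟩ := Int.eq_ofNat_of_zero_le hj
    rw [intCoeff_natCast, intCoeff_natCast]
    cases n with
    | zero => simp
    | succ n =>
      rw [coeff_succ_X_mul, coeff_derivative]
      push_cast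
      ring

theorem finsum_intCoeff_mul {R : Type*} [CommRing R] (x y : PowerSeries R) (K : ℤ) :
    ∑ᶠ m : ℤ, intCoeff x m * intCoeff y (K - m) = intCoeff (x * y) K := by
  rcases lt_or_ge K 0 with hK | hK
  · rw [intCoeff_of_neg _ hK]
    refine (finsum_congr fun m => ?_).trans finsum_zero
    rcases lt_or_ge m 0 with hm | hm
    · rw [intCoeff_of_neg _ hm, zero_mul]
    · rw [intCoeff_of_neg y (by omega), mul_zero]
  · obtain ⟨n, rfl⟩ := Int.eq_ofNat_of_zero_le hK
    rw [intCoeff_natCast, coeff_mul, Finset.Nat.sum_antidiagonal_eq_sum_range_succ_mk,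
      finsum_eq_sum_of_support_subset (s := (Finset.range (n + 1)).map Nat.castEmbedding),
      Finset.sum_map]
    · refine Finset.sum_congr rfl fun m hm => ?_
      rw [Finset.mem_range] at hm
      rw [Nat.castEmbedding_apply, intCoeff_natCast, ← Nat.cast_sub (by omega), intCoeff_natCast]
    · intro m hm
      rw [Function.mem_support] at hm
      rw [Finset.mem_coe, Finset.mem_map]
      have h1 : 0 ≤ m := by
        by_contra h
        exact hm (by rw [intCoeff_of_neg _ (by omega), zero_mul])
      have h2 : 0 ≤ n - m := by
        by_contra h
        exact hm (by rw [intCoeff_of_neg y (by omega), mul_zero])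
      exact ⟨m.toNat, by rw [Finset.mem_range]; omega, by simp [h1]⟩

end CommExponential

end FieldCalculus

/-! ### Heisenberg modes on the lattice space -/

namespace LatticeVertexAlgebra

open FieldCalculus
open HVertexOperator (coeff)

variable {L : Type*} [AddCommGroup L]

theorem heisMode_zero_single (B : LinearMap.BilinForm ℤ L) (a : Cartan L) (μ : L) (s : Fock L) :
    heisMode B a 0 (Finsupp.single μ s) = form B a (incl μ) • Finsupp.single μ s := by
  change (Finsupp.lsum ℂ fun μ => form B a (incl μ) • Finsupp.lsingle μ) (Finsupp.single μ s) = _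
  simp

theorem heisMode_succ_single (B : LinearMap.BilinForm ℤ L) (a : Cartan L) (n : ℕ) (μ : L)
    (s : Fock L) :
    heisMode B a (n + 1) (Finsupp.single μ s) = Finsupp.single μ (annihilate B n a s) := by
  change (Finsupp.mapRange.linearMap (annihilate B n a : Fock L →ₗ[ℂ] Fock L))
    (Finsupp.single μ s) = _
  simp

theorem heisMode_negSucc_single (B : LinearMap.BilinForm ℤ L) (a : Cartan L) (n : ℕ) (μ : L)
    (s : Fock L) :
    heisMode B a (-n - 1) (Finsupp.single μ s) = Finsupp.single μ (gen n a * s) := by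
  rw [show (-n - 1 : ℤ) = Int.negSucc n by rw [Int.negSucc_eq]; ring]
  change (Finsupp.mapRange.linearMap (LinearMap.mulLeft ℂ (gen n a))) (Finsupp.single μ s) = _
  simp

theorem coeff_heis (B : LinearMap.BilinForm ℤ L) (a : Cartan L) (i : ℤ) :
    coeff (heis B a) i = heisMode B a (-i - 1) := rfl

/-- The trichotomy of Heisenberg modes: zero mode, annihilation operator, creation operator. -/
theorem int_cases (m : ℤ) : m = 0 ∨ (∃ n : ℕ, m = n + 1) ∨ ∃ n : ℕ, m = -n - 1 := by
  rcases lt_trichotomy m 0 with h | h | h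
  · exact Or.inr (Or.inr ⟨(-m - 1).toNat, by omega⟩)
  · exact Or.inl h
  · exact Or.inr (Or.inl ⟨(m - 1).toNat, by omega⟩)

theorem annihilate_ι (B : LinearMap.BilinForm ℤ L) (n : ℕ) (a : Cartan L) (x : ℕ →₀ Cartan L) :
    annihilate B n a (SymmetricAlgebra.ι ℂ _ x) = algebraMap ℂ (Fock L) (contract B n a x) := by
  simp [annihilate, annihilateHom, Algebra.algebraMap_eq_smul_one]

theorem annihilate_comm (B : LinearMap.BilinForm ℤ L) (m n : ℕ) (a b : Cartan L) (s : Fock L) :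
    annihilate B m a (annihilate B n b s) = annihilate B n b (annihilate B m a s) := by
  induction s using SymmetricAlgebra.induction with
  | algebraMap r => simp
  | ι x => simp [annihilate_ι]
  | mul s t hs ht =>
    simp only [Derivation.leibniz, map_add, smul_eq_mul, hs, ht]
    ring
  | add s t hs ht => simp only [map_add, hs, ht]

theorem form_comm {B : LinearMap.BilinForm ℤ L} (hB : B.IsSymm) (a b : Cartan L) :
    form B a b = form B b a := by
  induction a using TensorProduct.induction_on with
  | zero => simp
  | add a a' h h' => rw [map_add, map_add, LinearMap.add_apply, h, h']
  | tmul c l =>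
    induction b using TensorProduct.induction_on with
    | zero => simp
    | add b b' h h' => rw [map_add, map_add, LinearMap.add_apply, h, h']
    | tmul c' l' => simp [form, hB.eq l l', mul_comm c]

theorem heisMode_comm (B : LinearMap.BilinForm ℤ L) (hB : B.IsSymm) (a b : Cartan L) (m n : ℤ)
    (v : Space L) :
    heisMode B a m (heisMode B b n v) = heisMode B b n (heisMode B a m v) +
      (if m + n = 0 then (m : ℂ) * form B a b else 0) • v := by
  have hsymm : form B b a = form B a b := form_comm hB b a
  induction v using Finsupp.induction_linear with
  | zero => simp
  | add v w hv hw =>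
    simp only [map_add, hv, hw, smul_add]
    abel
  | single μ s =>
    rcases int_cases m with rfl | ⟨m, rfl⟩ | ⟨m, rfl⟩ <;>
    rcases int_cases n with rfl | ⟨n, rfl⟩ | ⟨n, rfl⟩ <;>
    simp only [heisMode_zero_single, heisMode_succ_single, heisMode_negSucc_single, map_smul]
    · simp [mul_comm, smul_smul]
    · rw [if_neg (by omega)]; simp
    · rw [if_neg (by omega)]; simp
    · rw [if_neg (by omega)]; simp
    · rw [if_neg (by omega), annihilate_comm]; simp
    · rw [Derivation.leibniz, annihilate_gen, Finsupp.smul_single, ← Finsupp.single_add,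
        smul_eq_mul, smul_eq_mul, mul_comm s, ← Algebra.smul_def]
      by_cases h : n = m
      · rw [if_pos h, if_pos (by omega)]
        push_cast
        rfl
      · rw [if_neg h, if_neg (by omega)]
    · rw [if_neg (by omega)]; simp
    · rw [Derivation.leibniz, annihilate_gen, Finsupp.smul_single, ← Finsupp.single_add,
        smul_eq_mul, smul_eq_mul, mul_comm s, ← Algebra.smul_def]
      by_cases h : m = n
      · rw [if_pos h, if_pos (by omega), h, hsymm, add_assoc, ← add_smul]
        push_cast
        simp
        ring_nf
        simp
      · rw [if_neg h, if_neg (by omega)]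
        simp
    · rw [if_neg (by omega), mul_left_comm]; simp

/-- A subset of `V_L` closed under linear combinations and creation operators that contains the
highest weight vectors `e^μ ⊗ 1` is everything. -/
theorem space_induction (B : LinearMap.BilinForm ℤ L) {p : Space L → Prop}
    (vac : ∀ μ, p (Finsupp.single μ 1)) (add : ∀ v w, p v → p w → p (v + w))
    (smul : ∀ (c : ℂ) v, p v → p (c • v))
    (creation : ∀ (a : Cartan L) (n : ℕ) v, p v → p (heisMode B a (-n - 1) v)) (v : Space L) :
    p v := by
  -- Multiplication by any `s` in the Fock space is a polynomial in the creation operators.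
  have key : ∀ (s t : Fock L) (μ : L), p (Finsupp.single μ t) → p (Finsupp.single μ (s * t)) := by
    intro s
    induction s using SymmetricAlgebra.induction with
    | algebraMap r =>
      intro t μ h
      rw [← Algebra.smul_def, ← Finsupp.smul_single]
      exact smul r _ h
    | ι x =>
      intro t μ h
      induction x using Finsupp.induction_linear with
      | zero =>
        rw [map_zero, zero_mul, ← zero_smul ℂ t, ← Finsupp.smul_single]
        exact smul 0 _ h
      | add x y hx hy =>
        rw [map_add, add_mul, Finsupp.single_add]
        exact add _ _ hx hy
      | single n a =>
        have := creation a n _ h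
        rwa [heisMode_negSucc_single] at this
    | mul s s' hs hs' =>
      intro t μ h
      rw [mul_assoc]
      exact hs _ _ (hs' _ _ h)
    | add s s' hs hs' =>
      intro t μ h
      rw [add_mul, Finsupp.single_add]
      exact add _ _ (hs _ _ h) (hs' _ _ h)
  induction v using Finsupp.induction_linear with
  | zero => simpa using smul 0 _ (vac 0)
  | add v w hv hw => exact add _ _ hv hw
  | single μ s => simpa using key s 1 μ (vac μ)

/-- Two operators agree if they agree on the highest weight vectors `e^μ ⊗ 1` and their difference
commutes with the creation operators. -/
theorem eq_of_commute_creation (B : LinearMap.BilinForm ℤ L) {X Y : Module.End ℂ (Space L)}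
    (hX : ∀ (a : Cartan L) (n : ℕ) v,
      (X - Y) (heisMode B a (-n - 1) v) = heisMode B a (-n - 1) ((X - Y) v))
    (hvac : ∀ μ, X (Finsupp.single μ 1) = Y (Finsupp.single μ 1)) : X = Y := by
  rw [← sub_eq_zero]
  refine LinearMap.ext fun v => ?_
  rw [LinearMap.zero_apply]
  refine space_induction B (p := fun v => (X - Y) v = 0) (fun μ => ?_) (fun v w hv hw => ?_)
    (fun c v hv => ?_) (fun a n v hv => ?_) v
  · rw [LinearMap.sub_apply, hvac, sub_self]
  · rw [map_add, hv, hw, add_zero]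
  · rw [map_smul, hv, smul_zero]
  · rw [hX, hv, map_zero]

/-! ### Vertex operators -/

theorem vertexCoeff_single (B : LinearMap.BilinForm ℤ L) (ε : Cocycle B) (ν : L) (m : ℤ) (μ : L)
    (s : Fock L) :
    vertexCoeff B ε ν m (Finsupp.single μ s) =
      (((ε.val ν μ : ℤˣ) : ℤ) : ℂ) •
        Finsupp.single (ν + μ) (expCoeff B (incl ν) (m - B ν μ) s) := by
  simp [vertexCoeff]

theorem expTerm_eq (B : LinearMap.BilinForm ℤ L) (a : Cartan L) (j : ℤ) (q : ℕ) :
    expTerm B a j q = intCoeff (expSeries (creationSeries a)) (j + q) *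
      intCoeff (expSeries (annihilationSeries B a)) q := by
  rw [expTerm, intCoeff_natCast, intCoeff, ite_mul, zero_mul]

/-- The defining sum over `q : ℕ` as a sum over all integers, so that it can be reindexed by shifts. -/
theorem expCoeff_apply (B : LinearMap.BilinForm ℤ L) (a : Cartan L) (j : ℤ) (s : Fock L) :
    expCoeff B a j s = ∑ᶠ q : ℤ, intCoeff (expSeries (creationSeries a)) (j + q)
      (intCoeff (expSeries (annihilationSeries B a)) q s) := by
  rw [expCoeff, locSum_apply, finsum_congr fun q => by rw [expTerm_eq, Module.End.mul_apply],
    ← finsum_mem_range (g := fun q : ℕ => (q : ℤ)) (f := fun q : ℤ =>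
      intCoeff (expSeries (creationSeries a)) (j + q)
        (intCoeff (expSeries (annihilationSeries B a)) q s)) Nat.cast_injective,
    ← finsum_mem_univ (fun q : ℤ => intCoeff (expSeries (creationSeries a)) (j + q)
      (intCoeff (expSeries (annihilationSeries B a)) q s))]
  refine finsum_mem_inter_support_eq' _ _ _ fun q hq => ⟨fun _ => Set.mem_univ _, fun _ => ?_⟩
  rw [Function.mem_support] at hq
  have : 0 ≤ q := by
    by_contra h
    exact hq (by rw [intCoeff_of_neg _ (not_le.1 h)]; simp)
  exact ⟨q.toNat, by simp [this]⟩

theorem expCoeff_finite (B : LinearMap.BilinForm ℤ L) (a : Cartan L) (j : ℤ) (s : Fock L) :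
    (Function.support fun q : ℤ => intCoeff (expSeries (creationSeries a)) (j + q)
      (intCoeff (expSeries (annihilationSeries B a)) q s)).Finite := by
  obtain ⟨N, hN⟩ := exists_mem_weightLE s
  refine (Set.finite_Icc 0 N).subset fun q hq => ?_
  rw [Function.mem_support] at hq
  by_contra hmem
  apply hq
  rw [Set.mem_Icc] at hmem
  rcases lt_or_ge q 0 with h | h
  · rw [intCoeff_of_neg _ h, LinearMap.zero_apply, map_zero]
  · obtain ⟨n, rfl⟩ := Int.eq_ofNat_of_zero_le h
    rw [intCoeff_natCast, exp_annihilationSeries_eq_zero B a hN (by omega), map_zero]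

theorem coeff_zero_creationSeries (a : Cartan L) :
    PowerSeries.coeff 0 (creationSeries a) = 0 := by
  simp [creationSeries]

theorem coeff_zero_annihilationSeries (B : LinearMap.BilinForm ℤ L) (a : Cartan L) :
    PowerSeries.coeff 0 (annihilationSeries B a) = 0 := by
  simp [annihilationSeries]

theorem mul_left_intCoeff_creation (a b : Cartan L) (n : ℕ) (j : ℤ) :
    LinearMap.mulLeft ℂ (gen n a) * intCoeff (expSeries (creationSeries b)) j =
      intCoeff (expSeries (creationSeries b)) j * LinearMap.mulLeft ℂ (gen n a) := by
  -- The commutator is zero: the rule applies with `c = 0` and any positive exponent.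
  have := mul_intCoeff_expSeries (coeff_zero_creationSeries b)
    (D := LinearMap.mulLeft ℂ (gen n a)) (c := 0) (p := 1) one_pos (fun m => ?_) j
  · simpa using this
  · rcases m with _ | m
    · simp [creationSeries]
    · simp only [creationSeries, PowerSeries.coeff_mk, map_zero, ite_self, add_zero]
      refine LinearMap.ext fun s => ?_
      simp [mul_left_comm]

theorem mul_left_intCoeff_annihilation (B : LinearMap.BilinForm ℤ L) (hB : B.IsSymm)
    (a b : Cartan L) (n : ℕ) (j : ℤ) :
    LinearMap.mulLeft ℂ (gen n a) * intCoeff (expSeries (annihilationSeries B b)) j =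
      intCoeff (expSeries (annihilationSeries B b)) j * LinearMap.mulLeft ℂ (gen n a) +
        form B a b • intCoeff (expSeries (annihilationSeries B b)) (j - (n + 1 : ℕ)) := by
  have hsymm : form B b a = form B a b := form_comm hB b a
  refine mul_intCoeff_expSeries (coeff_zero_annihilationSeries B b) n.succ_pos (fun m => ?_) j
  rcases m with _ | m
  · simp [annihilationSeries]
  · simp only [annihilationSeries, PowerSeries.coeff_mk]
    have hm : (m + 1 : ℂ) ≠ 0 := by exact_mod_cast m.succ_ne_zero
    refine LinearMap.ext fun s => ?_
    by_cases h : m = n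
    · subst h
      simp only [annihilate_gen, if_pos, Module.End.mul_apply, LinearMap.mulLeft_apply,
        LinearMap.neg_apply, LinearMap.smul_apply, Derivation.coeFn_coe, Derivation.leibniz,
        smul_eq_mul, LinearMap.add_apply, Module.algebraMap_end_apply]
      rw [mul_comm s, ← Algebra.smul_def, hsymm, smul_add, smul_smul, inv_mul_cancel_left₀ hm,
        mul_neg, mul_smul_comm]
      abel
    · simp [annihilate_gen, h, Ne.symm h]

theorem annihilate_mul_intCoeff_annihilation (B : LinearMap.BilinForm ℤ L) (a b : Cartan L) (n : ℕ)
    (j : ℤ) :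
    (annihilate B n a : Fock L →ₗ[ℂ] Fock L) * intCoeff (expSeries (annihilationSeries B b)) j =
      intCoeff (expSeries (annihilationSeries B b)) j *
        (annihilate B n a : Fock L →ₗ[ℂ] Fock L) := by
  have := mul_intCoeff_expSeries (coeff_zero_annihilationSeries B b)
    (D := (annihilate B n a : Fock L →ₗ[ℂ] Fock L)) (c := 0) (p := 1) one_pos (fun m => ?_) j
  · simpa using this
  · rcases m with _ | m
    · simp [annihilationSeries]
    · simp only [annihilationSeries, PowerSeries.coeff_mk, map_zero, ite_self, add_zero]
      refine LinearMap.ext fun s => ?_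
      simp [annihilate_comm B n m]

theorem annihilate_mul_intCoeff_creation (B : LinearMap.BilinForm ℤ L) (a b : Cartan L) (n : ℕ)
    (j : ℤ) :
    (annihilate B n a : Fock L →ₗ[ℂ] Fock L) * intCoeff (expSeries (creationSeries b)) j =
      intCoeff (expSeries (creationSeries b)) j * (annihilate B n a : Fock L →ₗ[ℂ] Fock L) +
        form B a b • intCoeff (expSeries (creationSeries b)) (j - (n + 1 : ℕ)) := by
  refine mul_intCoeff_expSeries (coeff_zero_creationSeries b) n.succ_pos (fun m => ?_) j
  rcases m with _ | m
  · simp [creationSeries]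
  · simp only [creationSeries, PowerSeries.coeff_mk]
    have hm : (m + 1 : ℂ) ≠ 0 := by exact_mod_cast m.succ_ne_zero
    refine LinearMap.ext fun s => ?_
    by_cases h : m = n
    · subst h
      simp only [annihilate_gen, if_pos, Module.End.mul_apply, LinearMap.mulLeft_apply,
        LinearMap.smul_apply, Derivation.coeFn_coe, Derivation.leibniz,
        smul_eq_mul, LinearMap.add_apply, Module.algebraMap_end_apply, Derivation.map_smul]
      rw [mul_comm s, ← Algebra.smul_def, smul_add, smul_smul, inv_mul_cancel_left₀ hm]
    · simp [annihilate_gen, h]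

/-- The commutator of a creation operator with the exponentials comes from the annihilation half
alone; reindexing the sum turns the shift of its exponent into a shift of `j`. -/
theorem gen_mul_expCoeff (B : LinearMap.BilinForm ℤ L) (hB : B.IsSymm) (a b : Cartan L) (n : ℕ)
    (j : ℤ) (s : Fock L) :
    gen n a * expCoeff B b j s =
      expCoeff B b j (gen n a * s) + form B a b • expCoeff B b (j + n + 1) s := by
  rw [expCoeff_apply, expCoeff_apply, expCoeff_apply, ← LinearMap.mulLeft_apply (R := ℂ),
    map_finsum _ (expCoeff_finite B b j s), smul_finsum,
    ← finsum_comp_equiv (Equiv.subRight (n + 1 : ℤ)) (f := fun q : ℤ => form B a b •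
      intCoeff (expSeries (creationSeries b)) (j + n + 1 + q)
      (intCoeff (expSeries (annihilationSeries B b)) q s)), ← finsum_add_distrib]
  · refine finsum_congr fun q => ?_
    have h1 := LinearMap.congr_fun (mul_left_intCoeff_creation a b n (j + q))
      (intCoeff (expSeries (annihilationSeries B b)) q s)
    have h2 := LinearMap.congr_fun (mul_left_intCoeff_annihilation B hB a b n q) s
    rw [Module.End.mul_apply, Module.End.mul_apply] at h1
    rw [LinearMap.add_apply, Module.End.mul_apply, Module.End.mul_apply] at h2
    rw [h1, h2, map_add, LinearMap.smul_apply, map_smul, LinearMap.mulLeft_apply,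
      Equiv.subRight_apply, show j + n + 1 + (q - (n + 1)) = j + q by ring]
    push_cast
    rfl
  · exact expCoeff_finite B b j _
  · exact (finite_support_smul _ (expCoeff_finite B b (j + n + 1) s)).preimage
      (Equiv.subRight (n + 1 : ℤ)).injective.injOn

/-- The commutator of an annihilation operator with the exponentials comes from the creation half
alone. -/
theorem annihilate_expCoeff (B : LinearMap.BilinForm ℤ L) (a b : Cartan L) (n : ℕ)
    (j : ℤ) (s : Fock L) :
    annihilate B n a (expCoeff B b j s) =
      expCoeff B b j (annihilate B n a s) + form B a b • expCoeff B b (j - (n + 1)) s := by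
  rw [expCoeff_apply, expCoeff_apply, expCoeff_apply, ← Derivation.coeFn_coe,
    map_finsum _ (expCoeff_finite B b j s), smul_finsum, ← finsum_add_distrib]
  · refine finsum_congr fun q => ?_
    have h1 := LinearMap.congr_fun (annihilate_mul_intCoeff_creation B a b n (j + q))
      (intCoeff (expSeries (annihilationSeries B b)) q s)
    have h2 := LinearMap.congr_fun (annihilate_mul_intCoeff_annihilation B a b n q) s
    rw [LinearMap.add_apply, Module.End.mul_apply, Module.End.mul_apply] at h1
    rw [Module.End.mul_apply, Module.End.mul_apply] at h2
    rw [h1, h2, LinearMap.smul_apply, show j - (n + 1) + q = j + q - (n + 1 : ℕ) by push_cast; ring]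
  · exact expCoeff_finite B b j _
  · exact finite_support_smul _ (expCoeff_finite B b (j - (n + 1)) s)

theorem form_incl_add (B : LinearMap.BilinForm ℤ L) (a : Cartan L) (μ ν : L) :
    form B a (incl (μ + ν)) = form B a (incl μ) + form B a (incl ν) := by
  rw [← map_add, incl, incl, incl, TensorProduct.tmul_add]

/-- `[a_(n), e^ν(z)] = (a|ν) zⁿ e^ν(z)`. -/
theorem heisMode_vertexCoeff (B : LinearMap.BilinForm ℤ L) (hB : B.IsSymm) (ε : Cocycle B)
    (a : Cartan L) (ν : L) (n m : ℤ) (v : Space L) :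
    heisMode B a n (vertexCoeff B ε ν m v) = vertexCoeff B ε ν m (heisMode B a n v) +
      form B a (incl ν) • vertexCoeff B ε ν (m - n) v := by
  induction v using Finsupp.induction_linear with
  | zero => simp
  | add v w hv hw =>
    simp only [map_add, hv, hw, smul_add]
    abel
  | single μ s =>
    rcases int_cases n with rfl | ⟨n, rfl⟩ | ⟨n, rfl⟩ <;>
    simp only [vertexCoeff_single, heisMode_zero_single, heisMode_succ_single,
      heisMode_negSucc_single, map_smul]
    · rw [form_incl_add, sub_zero, add_smul, smul_add, add_comm,
        smul_comm (form B a (incl ν)), smul_comm (form B a (incl μ))]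
    · rw [annihilate_expCoeff, Finsupp.single_add, smul_add,
        show m - (n + 1) - B ν μ = m - B ν μ - (n + 1) by ring, smul_comm (form B a (incl ν)),
        Finsupp.smul_single (form B a (incl ν))]
    · rw [gen_mul_expCoeff B hB, Finsupp.single_add, smul_add,
        show m - (-n - 1) - B ν μ = m - B ν μ + n + 1 by ring, smul_comm (form B a (incl ν)),
        Finsupp.smul_single (form B a (incl ν))]

end LatticeVertexAlgebra

/-! ### Vertex operators of isotropic vectors -/

namespace FieldCalculus

open HVertexOperator (coeff)

/-- Leibniz rule for the convolution of two commuting fields, weighted by a function `f` of the mode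
of `A`, under an operator `D` that maps each field to a multiple of itself, shifted by `s`. -/
theorem apply_weighted_convolution {V : Type*} [AddCommGroup V] [Module ℂ V]
    {A B : VertexOperator ℂ V} {D : Module.End ℂ V} {φ ψ : ℂ}
    {s : ℤ} (hA : ∀ m v, D (coeff A m v) = coeff A m (D v) + φ • coeff A (m + s) v)
    (hB : ∀ m v, D (coeff B m v) = coeff B m (D v) + ψ • coeff B (m + s) v)
    (hAB : ∀ i j v, coeff A i (coeff B j v) = coeff B j (coeff A i v)) (f : ℤ → ℂ) (K : ℤ)
    (v : V) :
    D (∑ᶠ i : ℤ, f i • coeff A i (coeff B (K - i) v)) =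
      ∑ᶠ i : ℤ, f i • coeff A i (coeff B (K - i) (D v)) +
        ∑ᶠ i : ℤ, (φ * f (i - s) + ψ * f i) • coeff A i (coeff B (K + s - i) v) := by
  have hfin : ∀ (g : ℤ → ℂ) (K : ℤ) (v : V),
      (Function.support fun i => g i • coeff A i (coeff B (K - i) v)).Finite := by
    intro g K v
    refine (finite_support_convolution hAB 0 K v).subset fun i hi h => hi ?_
    dsimp only at h ⊢
    rw [zero_add] at h
    rw [h, smul_zero]
  have hterm : ∀ i, D (f i • coeff A i (coeff B (K - i) v)) =
      f i • coeff A i (coeff B (K - i) (D v)) +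
        ((φ * f (i + s - s)) • coeff A (i + s) (coeff B (K + s - (i + s)) v) +
          (ψ * f i) • coeff A i (coeff B (K + s - i) v)) := by
    intro i
    rw [map_smul, hA, hB, map_add, map_smul, add_sub_cancel_right,
      show K + s - (i + s) = K - i by ring, show K - i + s = K + s - i by ring]
    module
  rw [map_finsum _ (hfin f K v), finsum_congr hterm, finsum_add_distrib (hfin f K (D v)),
    finsum_add_distrib]
  · have hshift := finsum_comp_equiv (Equiv.addRight s)
      (f := fun i => (φ * f (i - s)) • coeff A i (coeff B (K + s - i) v))
    simp only [Equiv.coe_addRight] at hshift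
    rw [hshift, ← finsum_add_distrib]
    · simp only [add_smul]
    · exact hfin (fun i => φ * f (i - s)) (K + s) v
    · exact hfin (fun i => ψ * f i) (K + s) v
  · exact (hfin (fun i => φ * f (i - s)) (K + s) v).preimage (Equiv.addRight s).injective.injOn
  · exact hfin (fun i => ψ * f i) (K + s) v
  · exact ((hfin (fun i => φ * f (i - s)) (K + s) v).preimage
      (Equiv.addRight s).injective.injOn).union (hfin (fun i => ψ * f i) (K + s) v) |>.subset
      (Function.support_add _ _)

end FieldCalculus

namespace LatticeVertexAlgebra

open FieldCalculus
open HVertexOperator (coeff)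

variable {L : Type*} [AddCommGroup L]

/-- The series `∑_{n ≥ 1} a_(-n) zⁿ / n` with coefficients in the Fock space. -/
def fockSeries (a : Cartan L) : PowerSeries (Fock L) :=
  PowerSeries.mk fun
    | 0 => 0
    | n + 1 => ((n + 1 : ℂ)⁻¹) • gen n a

/-- The coefficients of `exp (∑_{n ≥ 1} a_(-n) zⁿ / n)` in the Fock space. -/
def schur (a : Cartan L) (j : ℤ) : Fock L := intCoeff (expSeries (fockSeries a)) j

theorem coeff_zero_fockSeries (a : Cartan L) : PowerSeries.coeff 0 (fockSeries a) = 0 := by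
  simp [fockSeries]

theorem gen_neg (n : ℕ) (a : Cartan L) : gen n (-a) = -gen n a := by
  simp [gen]

theorem fockSeries_neg (a : Cartan L) : fockSeries (-a) = -fockSeries a := by
  ext m
  rcases m with _ | m
  · simp [fockSeries]
  · simp [fockSeries, gen_neg]

theorem intCoeff_creation (a : Cartan L) (j : ℤ) (s : Fock L) :
    intCoeff (expSeries (creationSeries a)) j s = schur a j * s := by
  have h : creationSeries a =
      PowerSeries.map ((Algebra.lmul ℂ (Fock L) : Fock L →ₐ[ℂ] Module.End ℂ (Fock L)) :
        Fock L →+* Module.End ℂ (Fock L)) (fockSeries a) := by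
    ext m : 1
    rcases m with _ | m
    · simp [creationSeries, fockSeries]
    · simp only [creationSeries, fockSeries, PowerSeries.coeff_map, PowerSeries.coeff_mk,
        RingHom.coe_coe, map_smul]
      rfl
  rw [schur, intCoeff, intCoeff]
  split_ifs
  · rw [h, coeff_expSeries_map]
    rfl
  · simp

/-- On a vector killed by all the `a_(n)` with `n > 0`, the vertex operator of `a` is given by
its creation part. -/
theorem expCoeff_of_annihilate_eq_zero {B : LinearMap.BilinForm ℤ L} {a : Cartan L} {s : Fock L}
    (hs : ∀ n, annihilate B n a s = 0) (j : ℤ) : expCoeff B a j s = schur a j * s := by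
  have hx : ∀ m, PowerSeries.coeff m (annihilationSeries B a) s = 0 := by
    rintro (_ | m)
    · simp [annihilationSeries]
    · simp [annihilationSeries, hs]
  have hpow : ∀ r m : ℕ, PowerSeries.coeff m (annihilationSeries B a ^ (r + 1)) s = 0 := by
    intro r m
    rw [pow_succ, PowerSeries.coeff_mul, LinearMap.sum_apply]
    exact Finset.sum_eq_zero fun p _ => by rw [Module.End.mul_apply, hx, map_zero]
  have hexp : ∀ q : ℤ, intCoeff (expSeries (annihilationSeries B a)) q s =
      if q = 0 then s else 0 := by
    intro q
    rcases lt_or_ge q 0 with hq | hq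
    · rw [intCoeff_of_neg _ hq, if_neg (by omega), LinearMap.zero_apply]
    · obtain ⟨m, rfl⟩ := Int.eq_ofNat_of_zero_le hq
      rw [intCoeff_natCast, expSeries, PowerSeries.coeff_mk, Finset.sum_range_succ',
        LinearMap.add_apply, LinearMap.sum_apply, Finset.sum_eq_zero fun r _ => by
          rw [LinearMap.smul_apply, hpow, smul_zero], zero_add, pow_zero, PowerSeries.coeff_one]
      by_cases hm : m = 0 <;> simp [hm]
  rw [expCoeff_apply, finsum_eq_single _ 0 fun q hq => by rw [hexp, if_neg hq, map_zero], hexp,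
    if_pos rfl, add_zero, intCoeff_creation]

theorem annihilate_schur (B : LinearMap.BilinForm ℤ L) (a b : Cartan L) (n : ℕ) (j : ℤ) :
    annihilate B n a (schur b j) = form B a b • schur b (j - (n + 1)) := by
  have h := annihilate_expCoeff B a b n j 1
  have h1 : ∀ j, expCoeff B b j 1 = schur b j := fun j => by
    rw [expCoeff_of_annihilate_eq_zero (fun n => by simp), mul_one]
  simpa [h1] using h

theorem incl_neg (l : L) : incl (-l) = -incl l := by
  rw [incl, incl, TensorProduct.tmul_neg]

theorem Cocycle.zero_left {B : LinearMap.BilinForm ℤ L} (ε : Cocycle B) (b : L) :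
    ε.val 0 b = 1 := by
  have h := ε.add_left 0 0 b
  rw [add_zero] at h
  exact mul_eq_left.1 h.symm

theorem Cocycle.zero_right {B : LinearMap.BilinForm ℤ L} (ε : Cocycle B) (a : L) :
    ε.val a 0 = 1 := by
  have h := ε.add_right a 0 0
  rw [add_zero] at h
  exact mul_eq_left.1 h.symm

theorem Cocycle.neg_mul_self {B : LinearMap.BilinForm ℤ L} (ε : Cocycle B) (a b : L) :
    ε.val (-a) b * ε.val a b = 1 := by
  rw [← ε.add_left, neg_add_cancel, ε.zero_left]

theorem Cocycle.self_of_isotropic {B : LinearMap.BilinForm ℤ L} (ε : Cocycle B) {δ : L}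
    (hδ : B δ δ = 0) : ε.val δ δ = 1 := by
  rw [ε.self, hδ]
  rfl

theorem Cocycle.neg_right_of_isotropic {B : LinearMap.BilinForm ℤ L} (ε : Cocycle B) {δ : L}
    (hδ : B δ δ = 0) : ε.val δ (-δ) = 1 := by
  have h : ε.val δ (-δ) * ε.val δ δ = 1 := by
    rw [← ε.add_right, neg_add_cancel, ε.zero_right]
  rwa [ε.self_of_isotropic hδ, mul_one] at h

theorem Cocycle.neg_left_of_isotropic {B : LinearMap.BilinForm ℤ L} (ε : Cocycle B) {δ : L}
    (hδ : B δ δ = 0) : ε.val (-δ) δ = 1 := by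
  have h := ε.neg_mul_self δ δ
  rwa [ε.self_of_isotropic hδ, mul_one] at h

theorem vertexCoeff_single_one (B : LinearMap.BilinForm ℤ L) (ε : Cocycle B) (ν μ : L) (m : ℤ) :
    vertexCoeff B ε ν m (Finsupp.single μ 1) =
      (((ε.val ν μ : ℤˣ) : ℤ) : ℂ) • Finsupp.single (ν + μ) (schur (incl ν) (m - B ν μ)) := by
  rw [vertexCoeff_single, expCoeff_of_annihilate_eq_zero (fun n => by simp), mul_one]

/-- For orthogonal lattice vectors the annihilation half of the outer operator does not see the inner
one, so the composition on `e^μ ⊗ 1` is a product in the Fock space. -/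
theorem vertexCoeff_vertexCoeff_single_one {B : LinearMap.BilinForm ℤ L} (ε : Cocycle B) {ν ν' : L}
    (h : B ν ν' = 0) (μ : L) (m m' : ℤ) :
    vertexCoeff B ε ν m (vertexCoeff B ε ν' m' (Finsupp.single μ 1)) =
      (((ε.val ν ν' * ε.val ν μ * ε.val ν' μ : ℤˣ) : ℤ) : ℂ) •
        Finsupp.single (ν + (ν' + μ))
          (schur (incl ν) (m - B ν μ) * schur (incl ν') (m' - B ν' μ)) := by
  rw [vertexCoeff_single_one, map_smul, vertexCoeff_single,
    expCoeff_of_annihilate_eq_zero fun n => by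
      rw [annihilate_schur, form_incl, h, Int.cast_zero, zero_smul],
    map_add, h, zero_add, ε.add_right, smul_smul]
  push_cast
  rw [mul_comm (((ε.val ν' μ : ℤˣ) : ℤ) : ℂ)]

/-- The vertex operators of two orthogonal lattice vectors commute if the cocycle takes the same
value on the two orders of the vectors. -/
theorem vertexCoeff_comm {B : LinearMap.BilinForm ℤ L} (hB : B.IsSymm) (ε : Cocycle B) {ν ν' : L}
    (h : B ν ν' = 0) (hε : ε.val ν ν' = ε.val ν' ν) (m m' : ℤ) (v : Space L) :
    vertexCoeff B ε ν m (vertexCoeff B ε ν' m' v) =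
      vertexCoeff B ε ν' m' (vertexCoeff B ε ν m v) := by
  have h' : B ν' ν = 0 := by rw [hB.eq ν' ν]; exact h
  refine space_induction B (p := fun v => ∀ m m',
      vertexCoeff B ε ν m (vertexCoeff B ε ν' m' v) =
        vertexCoeff B ε ν' m' (vertexCoeff B ε ν m v)) (fun μ m m' => ?_)
    (fun v w hv hw m m' => ?_) (fun c v hv m m' => ?_) (fun a n v hv m m' => ?_) v m m'
  · rw [vertexCoeff_vertexCoeff_single_one ε h, vertexCoeff_vertexCoeff_single_one ε h', hε,
      mul_comm (schur _ _), mul_right_comm (ε.val ν' ν), add_left_comm]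
  · simp only [map_add, hv, hw]
  · simp only [map_smul, hv]
  · have hcomm : ∀ (ν : L) (m : ℤ) (v : Space L), vertexCoeff B ε ν m (heisMode B a (-n - 1) v) =
        heisMode B a (-n - 1) (vertexCoeff B ε ν m v) -
          form B a (incl ν) • vertexCoeff B ε ν (m - (-n - 1)) v := fun ν m v => by
      rw [heisMode_vertexCoeff B hB, add_sub_cancel_right]
    simp only [hcomm, map_sub, map_smul, hv]
    abel

theorem coeff_vertexOp (B : LinearMap.BilinForm ℤ L) (ε : Cocycle B) (ν : L) (m : ℤ) :
    coeff (vertexOp B ε ν) m = vertexCoeff B ε ν m := rfl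

theorem vertexOp_comm_self {B : LinearMap.BilinForm ℤ L} (hB : B.IsSymm) (ε : Cocycle B) {δ : L}
    (hδ : B δ δ = 0) (i j : ℤ) (v : Space L) :
    coeff (vertexOp B ε δ) i (coeff (vertexOp B ε δ) j v) =
      coeff (vertexOp B ε δ) j (coeff (vertexOp B ε δ) i v) :=
  vertexCoeff_comm hB ε hδ rfl i j v

theorem vertexOp_comm_neg {B : LinearMap.BilinForm ℤ L} (hB : B.IsSymm) (ε : Cocycle B) {δ : L}
    (hδ : B δ δ = 0) (i j : ℤ) (v : Space L) :
    coeff (vertexOp B ε δ) i (coeff (vertexOp B ε (-δ)) j v) =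
      coeff (vertexOp B ε (-δ)) j (coeff (vertexOp B ε δ) i v) :=
  vertexCoeff_comm hB ε (by rw [map_neg, hδ, neg_zero])
    (by rw [ε.neg_right_of_isotropic hδ, ε.neg_left_of_isotropic hδ]) i j v

theorem vertexOp_vertexOp_neg_single_one {B : LinearMap.BilinForm ℤ L} (ε : Cocycle B)
    {δ : L} (hδ : B δ δ = 0) (μ : L) (i j : ℤ) :
    coeff (vertexOp B ε δ) i (coeff (vertexOp B ε (-δ)) j (Finsupp.single μ 1)) =
      Finsupp.single μ (schur (incl δ) (i - B δ μ) * schur (-incl δ) (j + B δ μ)) := by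
  rw [coeff_vertexOp, coeff_vertexOp,
    vertexCoeff_vertexCoeff_single_one ε (by rw [map_neg, hδ, neg_zero]),
    ε.neg_right_of_isotropic hδ, one_mul, mul_comm (ε.val δ μ), ε.neg_mul_self, incl_neg, map_neg,
    LinearMap.neg_apply, sub_neg_eq_add, add_neg_cancel_left]
  simp

/-- The coefficients of `(f(z∂) e^δ(z)) e^{-δ}(z)` on `e^μ ⊗ 1`, for a weight function `f`. The series
`P` is `z^{-(δ|μ)} f(z∂) z^{(δ|μ)}` applied to the creation part of `e^δ(z)`. -/
theorem finsum_weighted_single_one {B : LinearMap.BilinForm ℤ L} (ε : Cocycle B)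
    {δ : L} (hδ : B δ δ = 0) (μ : L) (f : ℤ → ℂ) (P : PowerSeries (Fock L))
    (hP : ∀ m, intCoeff P m = f (m + B δ μ) • schur (incl δ) m) (K : ℤ) :
    ∑ᶠ i : ℤ, f i • coeff (vertexOp B ε δ) i
        (coeff (vertexOp B ε (-δ)) (K - i) (Finsupp.single μ 1)) =
      Finsupp.single μ (intCoeff (P * expSeries (-fockSeries (incl δ))) K) := by
  rw [← finsum_intCoeff_mul, ← finsum_comp_equiv (Equiv.addRight (B δ μ))]
  have hmap := (Finsupp.singleAddHom μ : Fock L →+ Space L).map_finsum_of_injective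
    (Finsupp.single_injective μ)
    (fun m => intCoeff P m * intCoeff (expSeries (-fockSeries (incl δ))) (K - m))
  simp only [Finsupp.singleAddHom_apply] at hmap
  rw [hmap]
  refine finsum_congr fun m => ?_
  rw [Equiv.coe_addRight, vertexOp_vertexOp_neg_single_one ε hδ, hP, Finsupp.smul_single,
    smul_mul_assoc, add_sub_cancel_right, sub_add_eq_sub_sub, sub_add_cancel, ← fockSeries_neg]
  rfl

theorem heis_vertexOp_leibniz {B : LinearMap.BilinForm ℤ L} (hB : B.IsSymm) (ε : Cocycle B)
    {δ : L} (hδ : B δ δ = 0) (a : Cartan L) (n : ℤ) (f : ℤ → ℂ) (K : ℤ) (v : Space L) :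
    heisMode B a n (∑ᶠ i : ℤ, f i • coeff (vertexOp B ε δ) i
        (coeff (vertexOp B ε (-δ)) (K - i) v)) =
      ∑ᶠ i : ℤ, f i • coeff (vertexOp B ε δ) i
        (coeff (vertexOp B ε (-δ)) (K - i) (heisMode B a n v)) +
      ∑ᶠ i : ℤ, (form B a (incl δ) * f (i - -n) + -form B a (incl δ) * f i) •
        coeff (vertexOp B ε δ) i (coeff (vertexOp B ε (-δ)) (K + -n - i) v) := by
  refine apply_weighted_convolution (fun m v => ?_) (fun m v => ?_)
    (vertexOp_comm_neg hB ε hδ) f K v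
  · exact heisMode_vertexCoeff B hB ε a δ n m v
  · rw [coeff_vertexOp, coeff_vertexOp, heisMode_vertexCoeff B hB ε a (-δ) n m v, incl_neg, map_neg,
      sub_eq_add_neg m]

/-- `e^δ(z) e^{-δ}(z) = 1` for isotropic `δ`: both sides commute with the Heisenberg modes, and on
`e^μ ⊗ 1` this is `exp x · exp (-x) = 1`. -/
theorem coeff_nop_vertexOp_neg {B : LinearMap.BilinForm ℤ L} (hB : B.IsSymm) (ε : Cocycle B)
    {δ : L} (hδ : B δ δ = 0) (K : ℤ) :
    coeff (nop (vertexOp B ε δ) (vertexOp B ε (-δ))) K =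
      if K = 0 then (1 : Module.End ℂ (Space L)) else 0 := by
  have hnop : ∀ v, coeff (nop (vertexOp B ε δ) (vertexOp B ε (-δ))) K v =
      ∑ᶠ i : ℤ, (1 : ℂ) • coeff (vertexOp B ε δ) i (coeff (vertexOp B ε (-δ)) (K - i) v) := by
    intro v
    simp only [one_smul]
    exact coeff_nop_apply_of_commute (vertexOp_comm_neg hB ε hδ) K v
  refine eq_of_commute_creation B (fun a n v => ?_) (fun μ => ?_)
  · rw [LinearMap.sub_apply, LinearMap.sub_apply, map_sub, hnop v,
      heis_vertexOp_leibniz hB ε hδ, ← hnop]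
    simp only [mul_one, add_neg_cancel, zero_smul, finsum_zero, add_zero]
    split_ifs <;> simp
  · rw [hnop, finsum_weighted_single_one ε hδ μ (fun _ => 1) (expSeries (fockSeries (incl δ)))
      (fun m => by rw [one_smul]; rfl), expSeries_mul_expSeries_neg (coeff_zero_fockSeries _),
      intCoeff_one]
    split_ifs <;> simp

theorem intCoeff_X_mul_derivative_fockSeries (a : Cartan L) (n : ℕ) :
    intCoeff (PowerSeries.X * PowerSeries.derivative (Fock L) (fockSeries a)) (n + 1) =
      gen n a := by
  have hn : (n + 1 : ℂ) ≠ 0 := by exact_mod_cast n.succ_ne_zero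
  have h : ((n : Fock L) + 1) = algebraMap ℂ (Fock L) (n + 1) := by simp
  rw [intCoeff_X_mul_derivative, ← Nat.cast_succ, intCoeff_natCast, fockSeries,
    PowerSeries.coeff_mk]
  push_cast
  rw [h, ← Algebra.smul_def, smul_smul, mul_inv_cancel₀ hn, one_smul]

/-- `∂e^δ(z) e^{-δ}(z)` is the Heisenberg field of `δ`, for isotropic `δ`. On `e^μ ⊗ 1` this is the
identity `(exp x)' exp (-x) = x'` for the exponent `x` of the creation part, together with the
derivative `(δ|μ) z^{(δ|μ) - 1}` of the factor `z^{(δ|μ)}`. -/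
theorem coeff_nop_eulerDeriv_vertexOp_neg {B : LinearMap.BilinForm ℤ L} (hB : B.IsSymm)
    (ε : Cocycle B) {δ : L} (hδ : B δ δ = 0) (K : ℤ) :
    coeff (nop (eulerDeriv (vertexOp B ε δ)) (vertexOp B ε (-δ))) K =
      heisMode B (incl δ) (-K) := by
  have hnop : ∀ v, coeff (nop (eulerDeriv (vertexOp B ε δ)) (vertexOp B ε (-δ))) K v =
      ∑ᶠ i : ℤ, (i : ℂ) • coeff (vertexOp B ε δ) i (coeff (vertexOp B ε (-δ)) (K - i) v) :=
    coeff_nop_apply_of_commute (eulerDeriv_commute (vertexOp_comm_neg hB ε hδ)) K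
  refine eq_of_commute_creation B (fun a n v => ?_) (fun μ => ?_)
  · rw [LinearMap.sub_apply, LinearMap.sub_apply, map_sub, hnop v,
      heis_vertexOp_leibniz hB ε hδ, ← hnop, heisMode_comm B hB a (incl δ)]
    -- The weights `i` do not cancel but leave a constant multiple of `e^δ e^{-δ} = 1`, which is the
    -- commutator of the Heisenberg modes.
    have hw : ∀ i : ℤ, (form B a (incl δ) * ((i - -(-n - 1) : ℤ) : ℂ) +
        -form B a (incl δ) * (i : ℂ)) = form B a (incl δ) * (-n - 1) := by
      intro i
      push_cast
      ring
    simp only [hw]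
    rw [← smul_finsum, ← coeff_nop_apply_of_commute (vertexOp_comm_neg hB ε hδ),
      coeff_nop_vertexOp_neg hB ε hδ]
    by_cases hK : K = -n - 1
    · rw [if_pos (by omega), if_pos (by omega), Module.End.one_apply]
      push_cast
      module
    · rw [if_neg (by omega), if_neg (by omega)]
      simp
  · have hP : ∀ m, intCoeff (PowerSeries.X * PowerSeries.derivative (Fock L)
        (expSeries (fockSeries (incl δ))) +
        PowerSeries.C ((B δ μ : ℤ) : Fock L) * expSeries (fockSeries (incl δ))) m =
        ((m + B δ μ : ℤ) : ℂ) • schur (incl δ) m := by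
      intro m
      have h : intCoeff (PowerSeries.X * PowerSeries.derivative (Fock L)
        (expSeries (fockSeries (incl δ))) +
        PowerSeries.C ((B δ μ : ℤ) : Fock L) * expSeries (fockSeries (incl δ))) m =
        intCoeff (PowerSeries.X * PowerSeries.derivative (Fock L)
        (expSeries (fockSeries (incl δ)))) m + ((B δ μ : ℤ) : Fock L) * schur (incl δ) m := by
        simp only [schur, intCoeff]
        split_ifs
        · rw [map_add, PowerSeries.coeff_C_mul]
        · simp
      rw [h, intCoeff_X_mul_derivative, schur, ← add_mul, Algebra.smul_def]
      simp
    have hE := expSeries_mul_expSeries_neg (coeff_zero_fockSeries (incl δ))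
    have hPE : (PowerSeries.X * (expSeries (fockSeries (incl δ)) *
        PowerSeries.derivative (Fock L) (fockSeries (incl δ))) +
        PowerSeries.C ((B δ μ : ℤ) : Fock L) * expSeries (fockSeries (incl δ))) *
        expSeries (-fockSeries (incl δ)) =
        PowerSeries.X * PowerSeries.derivative (Fock L) (fockSeries (incl δ)) +
        PowerSeries.C ((B δ μ : ℤ) : Fock L) := by
      linear_combination (PowerSeries.X * PowerSeries.derivative (Fock L) (fockSeries (incl δ)) +
        PowerSeries.C ((B δ μ : ℤ) : Fock L)) * hE
    rw [hnop, finsum_weighted_single_one ε hδ μ (fun i => (i : ℂ)) _ hP,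
      derivative_expSeries (coeff_zero_fockSeries _), hPE]
    rcases int_cases K with rfl | ⟨n, rfl⟩ | ⟨n, rfl⟩
    · rw [neg_zero, heisMode_zero_single, form_incl]
      simp [intCoeff, Algebra.smul_def]
    · rw [show (-((n : ℤ) + 1)) = -n - 1 by ring, heisMode_negSucc_single, mul_one,
        ← intCoeff_X_mul_derivative_fockSeries]
      congr 1
      rw [← Nat.cast_succ, intCoeff_natCast, intCoeff_natCast, map_add, PowerSeries.coeff_C,
        if_neg (by omega), add_zero]
    · rw [show (-(-(n : ℤ) - 1)) = n + 1 by ring, heisMode_succ_single, intCoeff_of_neg _ (by omega)]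
      simp

end LatticeVertexAlgebra

/-! ### Generators and representations of the affine algebra -/

namespace AffineSl2

attribute [local instance] LieRing.ofAssociativeRing

theorem e_val : e.val = !![0, 1; 0, 0] := by
  ext i j
  fin_cases i <;> fin_cases j <;> simp [e, LieAlgebra.SpecialLinear.val_single]

theorem h_val : h.val = !![1, 0; 0, -1] := by
  ext i j
  fin_cases i <;> fin_cases j <;> simp [h, LieAlgebra.SpecialLinear.val_singleSubSingle]

theorem f_val : f.val = !![0, 0; 1, 0] := by
  ext i j
  fin_cases i <;> fin_cases j <;> simp [f, LieAlgebra.SpecialLinear.val_single]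

theorem val_add (x y : Sl2) : (x + y).val = x.val + y.val := rfl

theorem val_smul (c : ℂ) (x : Sl2) : (c • x).val = c • x.val := rfl

theorem lie_h_e : ⁅h, e⁆ = (2 : ℂ) • e := by
  apply Subtype.ext
  rw [LieAlgebra.SpecialLinear.sl_bracket, val_smul, h_val, e_val]
  ext i j
  fin_cases i <;> fin_cases j <;> simp <;> norm_num

theorem lie_h_f : ⁅h, f⁆ = (-2 : ℂ) • f := by
  apply Subtype.ext
  rw [LieAlgebra.SpecialLinear.sl_bracket, val_smul, h_val, f_val]
  ext i j
  fin_cases i <;> fin_cases j <;> simp <;> norm_num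

theorem lie_e_f : ⁅e, f⁆ = h := by
  apply Subtype.ext
  rw [LieAlgebra.SpecialLinear.sl_bracket, h_val, e_val, f_val]
  ext i j
  fin_cases i <;> fin_cases j <;> simp

theorem trace_h_e : Matrix.trace (h.val * e.val) = 0 := by
  simp [h_val, e_val, Matrix.trace_fin_two]

theorem trace_h_f : Matrix.trace (h.val * f.val) = 0 := by
  simp [h_val, f_val, Matrix.trace_fin_two]

theorem trace_e_e : Matrix.trace (e.val * e.val) = 0 := by
  simp [e_val, Matrix.trace_fin_two]

theorem trace_f_f : Matrix.trace (f.val * f.val) = 0 := by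
  simp [f_val, Matrix.trace_fin_two]

theorem trace_e_f : Matrix.trace (e.val * f.val) = 1 := by
  simp [e_val, f_val, Matrix.trace_fin_two]

theorem sl2_apply_one_one (x : Sl2) : x.val 1 1 = -x.val 0 0 := by
  have hx : Matrix.trace x.val = 0 := by
    simpa [LieAlgebra.SpecialLinear.sl, LinearMap.mem_ker] using x.2
  rw [Matrix.trace_fin_two] at hx
  linear_combination hx

theorem sl2_eq (x : Sl2) : x = x.val 0 1 • e + x.val 0 0 • h + x.val 1 0 • f := by
  apply Subtype.ext
  rw [val_add, val_add, val_smul, val_smul, val_smul, e_val, h_val, f_val]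
  ext i j
  fin_cases i <;> fin_cases j <;> simp [sl2_apply_one_one]

theorem loop_add (x y : Sl2) (n : ℤ) : loop (x + y) n = loop x n + loop y n := by
  rw [loop, loop, loop, ← LieAlgebra.of_add, TensorProduct.tmul_add, Prod.mk_add_mk, add_zero]

theorem loop_smul (c : ℂ) (x : Sl2) (n : ℤ) : loop (c • x) n = c • loop x n := by
  rw [loop, loop, ← LieAlgebra.of_smul, TensorProduct.tmul_smul, Prod.smul_mk, smul_zero]

theorem loop_zero (n : ℤ) : loop 0 n = 0 := by
  simpa using loop_smul 0 0 n

/-- The affine algebra is spanned by the elements `x tⁿ` and `K`. -/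
theorem affine_induction {p : Affine → Prop} (loop : ∀ x n, p (loop x n)) (central : p K)
    (add : ∀ u w, p u → p w → p (u + w)) (smul : ∀ (c : ℂ) u, p u → p (c • u)) (u : Affine) :
    p u := by
  obtain ⟨⟨t, c⟩, rfl⟩ := (LieAlgebra.ofProd _).surjective u
  have hsplit : LieAlgebra.ofProd (LieAlgebra.LoopAlgebra.twoCocycleOfBilinear ℂ ℤ Sl2 negTraceForm
      negTraceForm_lieInvariant negTraceForm_isSymm) (t, c) = LieAlgebra.ofProd _ (t, 0) +
        (TrivialLieModule.equiv ℂ (LieAlgebra.loopAlgebra ℂ ℤ Sl2) ℂ c) • K := by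
    rw [K, ← LieAlgebra.of_smul, ← LieAlgebra.of_add, Prod.smul_mk, Prod.mk_add_mk, smul_zero,
      add_zero, zero_add, ← map_smul, smul_eq_mul, mul_one, LinearEquiv.symm_apply_apply]
  rw [hsplit]
  clear hsplit
  refine add _ _ ?_ (smul _ _ central)
  obtain ⟨g, rfl⟩ := (LieAlgebra.LoopAlgebra.toFinsupp ℂ ℤ Sl2).symm.surjective t
  induction g using Finsupp.induction_linear with
  | zero =>
    rw [map_zero, Prod.mk_zero_zero, LieAlgebra.of_zero]
    simpa using smul 0 _ central
  | add g g' hg hg' =>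
    have := add _ _ hg hg'
    rwa [← LieAlgebra.of_add, Prod.mk_add_mk, add_zero, ← map_add] at this
  | single n x =>
    rw [LieAlgebra.LoopAlgebra.toFinsupp_symm_single]
    exact loop x n

theorem loop_e_notMem_span (n : ℤ) : loop e n ∉ Submodule.span ℂ {K} := by
  intro hmem
  obtain ⟨c, hc⟩ := Submodule.mem_span_singleton.1 hmem
  have h1 := congrArg (fun u : Affine =>
    LieAlgebra.LoopAlgebra.toFinsupp ℂ ℤ Sl2 ((LieAlgebra.ofProd _).symm u).1 n) hc
  simp only [loop, K, LieAlgebra.of_symm_smul, Equiv.symm_apply_apply, Prod.smul_mk, smul_zero,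
    LieAlgebra.LoopAlgebra.toFinsupp_single_tmul, map_zero, Finsupp.zero_apply] at h1
  have h2 := congrArg (fun x : Sl2 => x.val 0 1) h1
  simp [e_val] at h2

theorem lie_loop_h_e (m n : ℤ) : ⁅loop h m, loop e n⁆ = (2 : ℂ) • loop e (m + n) := by
  rw [lie_loop_loop, lie_h_e, trace_h_e, loop_smul]
  simp

theorem lie_loop_h_f (m n : ℤ) : ⁅loop h m, loop f n⁆ = (-2 : ℂ) • loop f (m + n) := by
  rw [lie_loop_loop, lie_h_f, trace_h_f, loop_smul]
  simp

theorem lie_loop_e_e (m n : ℤ) : ⁅loop e m, loop e n⁆ = 0 := by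
  rw [lie_loop_loop, lie_self, trace_e_e, loop_zero]
  simp

theorem lie_loop_f_f (m n : ℤ) : ⁅loop f m, loop f n⁆ = 0 := by
  rw [lie_loop_loop, lie_self, trace_f_f, loop_zero]
  simp

theorem lie_loop_e_f (m n : ℤ) :
    ⁅loop e m, loop f n⁆ = loop h (m + n) + (if m + n = 0 then (m : ℂ) else 0) • K := by
  rw [lie_loop_loop, lie_e_f, trace_e_f, mul_one]

section Representation

variable {V : Type*} [AddCommGroup V] [Module ℂ V]

/-- The linear map `x tⁿ ↦ x₀₁ Eₙ + x₀₀ Hₙ + x₁₀ Fₙ`, `K ↦ k` on the affine algebra. -/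
def modeMap (k : ℂ) (E H F : ℤ → Module.End ℂ V) : Affine →ₗ[ℂ] Module.End ℂ V where
  toFun u := (LieAlgebra.LoopAlgebra.toFinsupp ℂ ℤ Sl2 ((LieAlgebra.ofProd _).symm u).1).sum
      (fun n x => x.val 0 1 • E n + x.val 0 0 • H n + x.val 1 0 • F n) +
    (TrivialLieModule.equiv ℂ (LieAlgebra.loopAlgebra ℂ ℤ Sl2) ℂ
      ((LieAlgebra.ofProd _).symm u).2) • k • (1 : Module.End ℂ V)
  map_add' u w := by
    rw [LieAlgebra.of_symm_add, Prod.fst_add, Prod.snd_add, map_add, map_add, add_smul,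
      Finsupp.sum_add_index' (fun n => by simp) (fun n x y => by simp; module)]
    abel
  map_smul' c u := by
    rw [LieAlgebra.of_symm_smul, Prod.smul_fst, Prod.smul_snd, map_smul, map_smul,
      Finsupp.sum_smul_index' (fun n => by simp), smul_add, Finsupp.smul_sum, RingHom.id_apply,
      smul_assoc]
    congr 1
    refine Finsupp.sum_congr fun n _ => ?_
    simp only [smul_add, smul_smul]
    rfl

theorem modeMap_loop (k : ℂ) (E H F : ℤ → Module.End ℂ V) (x : Sl2) (n : ℤ) :
    modeMap k E H F (loop x n) = x.val 0 1 • E n + x.val 0 0 • H n + x.val 1 0 • F n := by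
  simp only [modeMap, loop, LinearMap.coe_mk, AddHom.coe_mk, Equiv.symm_apply_apply,
    LieAlgebra.LoopAlgebra.toFinsupp_single_tmul, map_zero, zero_smul, add_zero]
  rw [Finsupp.sum_single_index (by simp)]

theorem modeMap_K (k : ℂ) (E H F : ℤ → Module.End ℂ V) :
    modeMap k E H F K = k • (1 : Module.End ℂ V) := by
  simp [modeMap, K]

theorem lie_eq_of_apply {X Y Z : Module.End ℂ V} (h : ∀ v, X (Y v) = Y (X v) + Z v) :
    ⁅X, Y⁆ = Z := by
  refine LinearMap.ext fun v => ?_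
  rw [Ring.lie_def, LinearMap.sub_apply, Module.End.mul_apply, Module.End.mul_apply, h,
    add_sub_cancel_left]

/-- Operators with the commutation relations of `e tⁿ`, `h tⁿ`, `f tⁿ` define a representation of
the affine algebra. -/
theorem exists_representation (k : ℂ) (E H F : ℤ → Module.End ℂ V)
    (hEE : ∀ m n, ⁅E m, E n⁆ = 0) (hFF : ∀ m n, ⁅F m, F n⁆ = 0)
    (hHE : ∀ m n, ⁅H m, E n⁆ = (2 : ℂ) • E (m + n))
    (hHF : ∀ m n, ⁅H m, F n⁆ = (-2 : ℂ) • F (m + n))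
    (hHH : ∀ m n, ⁅H m, H n⁆ = (if m + n = 0 then 2 * (m : ℂ) * k else 0) • (1 : Module.End ℂ V))
    (hEF : ∀ m n, ⁅E m, F n⁆ =
      H (m + n) + (if m + n = 0 then (m : ℂ) * k else 0) • (1 : Module.End ℂ V)) :
    ∃ ρ : Affine →ₗ⁅ℂ⁆ Module.End ℂ V, (∀ n, ρ (loop e n) = E n) ∧ (∀ n, ρ (loop h n) = H n) ∧
      (∀ n, ρ (loop f n) = F n) ∧ ρ K = k • (1 : Module.End ℂ V) := by
  have hEH : ∀ m n, ⁅E m, H n⁆ = (-2 : ℂ) • E (m + n) := fun m n => by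
    rw [← lie_skew, hHE, add_comm n m, neg_smul]
  have hFH : ∀ m n, ⁅F m, H n⁆ = (2 : ℂ) • F (m + n) := fun m n => by
    rw [← lie_skew, hHF, add_comm n m, neg_smul, neg_neg]
  have hFE : ∀ m n, ⁅F m, E n⁆ =
      -H (m + n) + (if m + n = 0 then (m : ℂ) * k else 0) • (1 : Module.End ℂ V) := fun m n => by
    rw [← lie_skew, hEF, add_comm n m, neg_add]
    split_ifs with h0
    · obtain rfl : n = -m := by omega
      push_cast
      module
    · simp
  have hone : ∀ (c : ℂ) (X : Module.End ℂ V), ⁅c • (1 : Module.End ℂ V), X⁆ = 0 := fun c X => by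
    rw [Ring.lie_def]
    simp
  have hone' : ∀ (c : ℂ) (X : Module.End ℂ V), ⁅X, c • (1 : Module.End ℂ V)⁆ = 0 := fun c X => by
    rw [Ring.lie_def]
    simp
  have key : ∀ u w, modeMap k E H F ⁅u, w⁆ = ⁅modeMap k E H F u, modeMap k E H F w⁆ := by
    intro u w
    induction u using affine_induction with
    | add u u' hu hu' => rw [add_lie, map_add, map_add, add_lie, hu, hu']
    | smul c u hu => rw [smul_lie, map_smul, map_smul, smul_lie, hu]
    | central => rw [← lie_skew, lie_K, modeMap_K, hone, neg_zero, map_zero]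
    | loop x m =>
      induction w using affine_induction with
      | add w w' hw hw' => rw [lie_add, map_add, map_add, lie_add, hw, hw']
      | smul c w hw => rw [lie_smul, map_smul, map_smul, lie_smul, hw]
      | central => rw [lie_K, modeMap_K, hone', map_zero]
      | loop y n =>
        rw [lie_loop_loop, map_add, map_smul, modeMap_K, modeMap_loop, modeMap_loop, modeMap_loop]
        simp only [lie_add, add_lie, lie_smul, smul_lie, hEE, hFF, hHE, hHF, hHH, hEF, hEH, hFH, hFE,
          LieAlgebra.SpecialLinear.sl_bracket, Matrix.sub_apply, Matrix.mul_apply, Fin.sum_univ_two,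
          Matrix.trace_fin_two, sl2_apply_one_one]
        split_ifs <;> module
  refine ⟨{ modeMap k E H F with map_lie' := fun {u w} => key u w }, fun n => ?_, fun n => ?_,
    fun n => ?_, modeMap_K k E H F⟩
  · refine (modeMap_loop k E H F e n).trans ?_
    simp [e_val]
  · refine (modeMap_loop k E H F h n).trans ?_
    simp [h_val]
  · refine (modeMap_loop k E H F f n).trans ?_
    simp [f_val]

theorem exists_eq_linearCombination (u : Affine) : ∃ (a b c : ℤ →₀ ℂ) (d : ℂ),
    u = Finsupp.linearCombination ℂ (loop e) a + Finsupp.linearCombination ℂ (loop h) b +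
      Finsupp.linearCombination ℂ (loop f) c + d • K := by
  induction u using affine_induction with
  | loop x n =>
    refine ⟨Finsupp.single n (x.val 0 1), Finsupp.single n (x.val 0 0),
      Finsupp.single n (x.val 1 0), 0, ?_⟩
    conv_lhs => rw [sl2_eq x]
    simp only [loop_add, loop_smul, Finsupp.linearCombination_single, zero_smul, add_zero]
  | central => exact ⟨0, 0, 0, 1, by simp⟩
  | add u w hu hw =>
    obtain ⟨a, b, c, d, rfl⟩ := hu
    obtain ⟨a', b', c', d', rfl⟩ := hw
    refine ⟨a + a', b + b', c + c', d + d', ?_⟩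
    simp only [map_add, add_smul]
    abel
  | smul r u hu =>
    obtain ⟨a, b, c, d, rfl⟩ := hu
    exact ⟨r • a, r • b, r • c, r * d, by simp only [map_smul, smul_add, mul_smul]⟩

theorem lie_linearCombination (u : Affine) (x : ℤ → Affine) (y : ℤ → Affine) (r : ℂ)
    (hxy : ∀ n, ⁅u, x n⁆ = r • y n) (a : ℤ →₀ ℂ) :
    ⁅u, Finsupp.linearCombination ℂ x a⁆ = r • Finsupp.linearCombination ℂ y a := by
  induction a using Finsupp.induction_linear with
  | zero => simp
  | add a a' h h' => rw [map_add, lie_add, h, h', map_add, smul_add]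
  | single n c =>
    rw [Finsupp.linearCombination_single, Finsupp.linearCombination_single, lie_smul, hxy,
      smul_comm]

/-- If the operators of the `h tⁿ` are linearly independent modulo scalars, then only multiples of
`K` act as zero. The kernel is stable under brackets; bracketing with `h t⁰` separates the `e`-, `h`-
and `f`-components of its elements, and bracketing with `f t⁰` or `e t⁰` turns the first and the last
into combinations of the `h tⁿ`. -/
theorem mem_span_K_of_eq_zero (ρ : Affine →ₗ⁅ℂ⁆ Module.End ℂ V)
    (hind : ∀ (b : ℤ →₀ ℂ) (d : ℂ),
      ρ (Finsupp.linearCombination ℂ (loop h) b + d • K) = 0 → b = 0)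
    {u : Affine} (hu : ρ u = 0) : u ∈ Submodule.span ℂ {K} := by
  obtain ⟨a, b, c, d, rfl⟩ := exists_eq_linearCombination u
  have hlie : ∀ w u, ρ u = 0 → ρ ⁅w, u⁆ = 0 := fun w u h => by rw [LieHom.map_lie, h, lie_zero]
  have hh : ∀ (a b c : ℤ →₀ ℂ) (d : ℂ), ⁅loop h 0, Finsupp.linearCombination ℂ (loop e) a +
      Finsupp.linearCombination ℂ (loop h) b + Finsupp.linearCombination ℂ (loop f) c + d • K⁆ =
      (2 : ℂ) • Finsupp.linearCombination ℂ (loop e) a +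
        (-2 : ℂ) • Finsupp.linearCombination ℂ (loop f) c := by
    intro a b c d
    rw [lie_add, lie_add, lie_add, lie_smul, lie_K,
      lie_linearCombination _ _ (loop e) 2 (fun n => by rw [lie_loop_h_e, zero_add]),
      lie_linearCombination _ _ (loop h) 0 (fun n => by
        rw [lie_loop_loop, lie_self, loop_zero]; simp),
      lie_linearCombination _ _ (loop f) (-2) (fun n => by rw [lie_loop_h_f, zero_add])]
    simp
  have h1 := hlie (loop h 0) _ hu
  rw [hh] at h1
  have h2 := hh ((2 : ℂ) • a) 0 ((-2 : ℂ) • c) 0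
  simp only [map_smul, map_zero, add_zero, zero_smul] at h2
  have h3 := hlie (loop h 0) _ h1
  rw [h2] at h3
  simp only [map_add, map_smul] at h1 h3 hu
  -- With `e(a)`, `f(c)` the `e`- and `f`-components, the kernel contains `2 e(a) - 2 f(c)` and
  -- `4 e(a) + 4 f(c)`.
  have hc : ρ (Finsupp.linearCombination ℂ (loop f) c) = 0 := by
    have h4 := congrArg₂ (fun X Y => (-1 / 4 : ℂ) • X + (1 / 8 : ℂ) • Y) h1 h3
    simp only [smul_zero, add_zero] at h4
    rw [← h4]
    module
  have ha : ρ (Finsupp.linearCombination ℂ (loop e) a) = 0 := by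
    have h4 := congrArg₂ (fun X Y => (1 / 4 : ℂ) • X + (1 / 8 : ℂ) • Y) h1 h3
    simp only [smul_zero, add_zero] at h4
    rw [← h4]
    module
  have hb : ρ (Finsupp.linearCombination ℂ (loop h) b + d • K) = 0 := by
    rw [ha, hc] at hu
    rw [map_add, map_smul, ← hu]
    abel
  -- Bracketing with `f t⁰` or `e t⁰` turns these components into combinations of the `h tⁿ`.
  have ha0 : a = 0 := by
    refine hind a 0 ?_
    have := hlie (loop f 0) _ ha
    rw [lie_linearCombination _ _ (loop h) (-1) (fun n => by
      rw [← lie_skew, lie_loop_e_f, add_zero]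
      split_ifs with h0
      · simp [h0]
      · simp)] at this
    simpa using this
  have hc0 : c = 0 := by
    refine hind c 0 ?_
    have := hlie (loop e 0) _ hc
    rw [lie_linearCombination _ _ (loop h) 1 (fun n => by rw [lie_loop_e_f]; simp)] at this
    simpa using this
  rw [ha0, hc0, hind b d hb]
  simpa using Submodule.smul_mem _ d (Submodule.mem_span_singleton_self K)

end Representation

end AffineSl2

/-! ### Commutators of the currents -/

namespace LatticeVertexAlgebra

open FieldCalculus
open HVertexOperator (coeff)
open VertexOperator (ncoeff)

variable {L : Type*} [AddCommGroup L]

theorem coeff_heis_comm {B : LinearMap.BilinForm ℤ L} (hB : B.IsSymm) (a b : Cartan L) (i j : ℤ)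
    (v : Space L) :
    coeff (heis B a) i (coeff (heis B b) j v) = coeff (heis B b) j (coeff (heis B a) i v) -
      (if i + j + 2 = 0 then ((i : ℂ) + 1) * form B a b else 0) • v := by
  rw [coeff_heis, coeff_heis, heisMode_comm B hB a b]
  by_cases h : i + j + 2 = 0
  · rw [if_pos h, if_pos (by omega)]
    push_cast
    module
  · rw [if_neg h, if_neg (by omega)]
    simp

theorem coeff_heis_vertexOp {B : LinearMap.BilinForm ℤ L} (hB : B.IsSymm) (ε : Cocycle B)
    (a : Cartan L) (ν : L) (i m : ℤ) (v : Space L) :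
    coeff (heis B a) i (coeff (vertexOp B ε ν) m v) =
      coeff (vertexOp B ε ν) m (coeff (heis B a) i v) +
        form B a (incl ν) • coeff (vertexOp B ε ν) (m + i + 1) v := by
  rw [coeff_heis, coeff_vertexOp, coeff_vertexOp, heisMode_vertexCoeff B hB,
    show m - (-i - 1) = m + i + 1 by ring]

theorem ncoeff_heis (B : LinearMap.BilinForm ℤ L) (a : Cartan L) (n : ℤ) :
    ncoeff (heis B a) n = heisMode B a n := by
  rw [VertexOperator.ncoeff_apply, coeff_heis, show -(-n - 1) - 1 = n by ring]

theorem gen_add (n : ℕ) (a b : Cartan L) : gen n (a + b) = gen n a + gen n b := by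
  simp [gen]

theorem gen_smul (n : ℕ) (c : ℂ) (a : Cartan L) : gen n (c • a) = c • gen n a := by
  rw [gen, gen, ← Finsupp.smul_single, map_smul]

theorem annihilate_add (B : LinearMap.BilinForm ℤ L) (n : ℕ) (a b : Cartan L) (s : Fock L) :
    annihilate B n (a + b) s = annihilate B n a s + annihilate B n b s := by
  induction s using SymmetricAlgebra.induction with
  | algebraMap r => simp
  | ι x => simp [annihilate_ι, contract]
  | mul s t hs ht =>
    simp only [Derivation.leibniz, smul_eq_mul, hs, ht]
    ring
  | add s t hs ht =>
    simp only [map_add, hs, ht]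
    abel

theorem annihilate_smul (B : LinearMap.BilinForm ℤ L) (n : ℕ) (c : ℂ) (a : Cartan L) (s : Fock L) :
    annihilate B n (c • a) s = c • annihilate B n a s := by
  induction s using SymmetricAlgebra.induction with
  | algebraMap r => simp
  | ι x =>
    simp only [annihilate_ι, Algebra.algebraMap_eq_smul_one, smul_smul]
    congr 1
    simp [contract]
    ring
  | mul s t hs ht =>
    simp only [Derivation.leibniz, smul_eq_mul, hs, ht, smul_add, mul_smul_comm]
  | add s t hs ht => simp only [map_add, hs, ht, smul_add]

theorem heisMode_add (B : LinearMap.BilinForm ℤ L) (a b : Cartan L) (n : ℤ) :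
    heisMode B (a + b) n = heisMode B a n + heisMode B b n := by
  refine LinearMap.ext fun v => ?_
  rw [LinearMap.add_apply]
  induction v using Finsupp.induction_linear with
  | zero => simp
  | add v w hv hw =>
    simp only [map_add, hv, hw]
    abel
  | single μ s =>
    rcases int_cases n with rfl | ⟨n, rfl⟩ | ⟨n, rfl⟩ <;>
    simp only [heisMode_zero_single, heisMode_succ_single, heisMode_negSucc_single]
    · rw [map_add, LinearMap.add_apply, add_smul]
    · rw [annihilate_add, Finsupp.single_add]
    · rw [gen_add, add_mul, Finsupp.single_add]

theorem heisMode_smul (B : LinearMap.BilinForm ℤ L) (c : ℂ) (a : Cartan L) (n : ℤ) :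
    heisMode B (c • a) n = c • heisMode B a n := by
  refine LinearMap.ext fun v => ?_
  rw [LinearMap.smul_apply]
  induction v using Finsupp.induction_linear with
  | zero => simp
  | add v w hv hw => simp only [map_add, hv, hw, smul_add]
  | single μ s =>
    rcases int_cases n with rfl | ⟨n, rfl⟩ | ⟨n, rfl⟩ <;>
    simp only [heisMode_zero_single, heisMode_succ_single, heisMode_negSucc_single]
    · rw [map_smul, LinearMap.smul_apply, smul_eq_mul, mul_smul]
    · rw [annihilate_smul, Finsupp.smul_single]
    · rw [gen_smul, smul_mul_assoc, Finsupp.smul_single]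

theorem gen_injective (n : ℕ) : Function.Injective (gen n : Cartan L → Fock L) := by
  intro a b hab
  rw [← sub_eq_zero, ← Module.forall_dual_apply_eq_zero_iff ℂ]
  intro g
  have h := congrArg (SymmetricAlgebra.lift (g ∘ₗ Finsupp.lapply n)) hab
  simp only [gen, SymmetricAlgebra.lift_ι_apply, LinearMap.comp_apply, Finsupp.lapply_apply,
    Finsupp.single_eq_same] at h
  rw [map_sub, h, sub_self]

/-- `a ↦ a_(-1)(e^0 ⊗ 1)` is injective. -/
theorem eq_of_heisMode_neg_one {B : LinearMap.BilinForm ℤ L} {a b : Cartan L}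
    (h : heisMode B a (-1) (Finsupp.single 0 1) = heisMode B b (-1) (Finsupp.single 0 1)) :
    a = b := by
  have hneg : (-1 : ℤ) = -(0 : ℕ) - 1 := by norm_num
  rw [hneg, heisMode_negSucc_single, heisMode_negSucc_single, mul_one, mul_one] at h
  exact gen_injective 0 (Finsupp.single_injective _ h)

theorem form_incl_neg (B : LinearMap.BilinForm ℤ L) (a : Cartan L) (ν : L) :
    form B a (incl (-ν)) = -form B a (incl ν) := by
  rw [incl_neg, map_neg]

/-- The field `:a(z) e^ν(z):`, for `a ∈ 𝔥` and `ν ∈ L`. -/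
abbrev current (B : LinearMap.BilinForm ℤ L) (ε : Cocycle B) (a : Cartan L) (ν : L) :
    VertexOperator ℂ (Space L) :=
  nop (heis B a) (vertexOp B ε ν)

/-- `[b_(m), :a e^ν:_(n)] = (b|ν) :a e^ν:_(m+n) + m (a|b) e^ν_(m+n-1)`. -/
theorem heisMode_ncoeff_current {B : LinearMap.BilinForm ℤ L} (hB : B.IsSymm) (ε : Cocycle B)
    (a b : Cartan L) (ν : L) (m n : ℤ) (v : Space L) :
    heisMode B b m (ncoeff (current B ε a ν) n v) =
      ncoeff (current B ε a ν) n (heisMode B b m v) +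
        form B b (incl ν) • ncoeff (current B ε a ν) (m + n) v +
        ((m : ℂ) * form B b a) • coeff (vertexOp B ε ν) (-m - n) v := by
  have h := heis_coeff_nop (coeff_heis_comm hB b a) (coeff_heis_vertexOp hB ε b ν) (-m - 1) (-n - 1)
    v
  rw [coeff_heis, show -(-m - 1) - 1 = m by ring, show -n - 1 + (-m - 1) + 1 = -(m + n) - 1 by ring,
    show -n - 1 + (-m - 1) + 2 = -m - n by ring] at h
  simp only [VertexOperator.ncoeff_apply]
  rw [h]
  push_cast
  module

/-- The modes of `:a e^ν:` commute up to a multiple of `(a|ν)² - (a|a)`, for isotropic `ν`. -/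
theorem coeff_current_self {B : LinearMap.BilinForm ℤ L} (hB : B.IsSymm) (ε : Cocycle B)
    (a : Cartan L) {ν : L} (hν : B ν ν = 0) (N M : ℤ) (v : Space L) :
    coeff (current B ε a ν) N (coeff (current B ε a ν) M v) =
      coeff (current B ε a ν) M (coeff (current B ε a ν) N v) +
        (form B a (incl ν) ^ 2 - form B a a) •
          (((N : ℂ) + 1) • coeff (nop (vertexOp B ε ν) (vertexOp B ε ν)) (N + M + 2) v -
            coeff (nop (eulerDeriv (vertexOp B ε ν)) (vertexOp B ε ν)) (N + M + 2) v) := by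
  rw [coeff_nop_coeff_nop (coeff_heis_comm hB a a) (coeff_heis_vertexOp hB ε a ν)
    (coeff_heis_vertexOp hB ε a ν) (coeff_heis_vertexOp hB ε a ν) (vertexOp_comm_self hB ε hν),
    add_sub_cancel_right, sq]

/-- If the modes of `:a e^ν:` commute then `(a|a) = (a|ν)²`, for isotropic `ν`. -/
theorem form_self_eq_of_comm {B : LinearMap.BilinForm ℤ L} (hB : B.IsSymm) (ε : Cocycle B)
    {a : Cartan L} {ν : L} (hν : B ν ν = 0)
    (h : ∀ N M v, coeff (current B ε a ν) N (coeff (current B ε a ν) M v) =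
      coeff (current B ε a ν) M (coeff (current B ε a ν) N v)) :
    form B a a = form B a (incl ν) ^ 2 := by
  -- The leading coefficient of `e^ν(z) e^ν(z)` on the vacuum `e^0 ⊗ 1` is `e^{2ν} ⊗ 1`, which is not
  -- zero.
  have hT : coeff (nop (vertexOp B ε ν) (vertexOp B ε ν)) 0 (Finsupp.single 0 1) =
      Finsupp.single (ν + (ν + 0)) 1 := by
    have hterm : ∀ i : ℤ, coeff (vertexOp B ε ν) i (coeff (vertexOp B ε ν) (0 - i)
        (Finsupp.single 0 1)) =
        Finsupp.single (ν + (ν + 0)) (schur (incl ν) i * schur (incl ν) (-i)) := by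
      intro i
      rw [coeff_vertexOp, coeff_vertexOp, vertexCoeff_vertexCoeff_single_one ε hν,
        ε.self_of_isotropic hν, ε.zero_right]
      simp
    rw [coeff_nop_apply_of_commute (vertexOp_comm_self hB ε hν), finsum_congr hterm,
      finsum_eq_single _ 0]
    · simp [schur, intCoeff, expSeries]
    · intro i hi
      rcases lt_or_gt_of_ne hi with h0 | h0
      · rw [schur, intCoeff_of_neg _ h0, zero_mul, Finsupp.single_zero]
      · rw [schur, schur, intCoeff_of_neg _ (show -i < 0 by omega), mul_zero, Finsupp.single_zero]
  -- Both `(N, M) = (0, -2)` and `(-2, 0)` give the coefficient of `z⁰`; in the difference of the two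
  -- relations the unknown derivative term cancels and `((N + 1) - (M + 1)) e^ν e^ν` is left.
  have h1 := h 0 (-2) (Finsupp.single 0 1)
  have h2 := h (-2) 0 (Finsupp.single 0 1)
  rw [coeff_current_self hB ε a hν, add_eq_left, show (0 : ℤ) + -2 + 2 = 0 by norm_num] at h1
  rw [coeff_current_self hB ε a hν, add_eq_left, show (-2 : ℤ) + 0 + 2 = 0 by norm_num] at h2
  rw [hT] at h1 h2
  have h3 : (2 * (form B a (incl ν) ^ 2 - form B a a)) •
      (Finsupp.single (ν + (ν + 0)) 1 : Space L) = 0 := by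
    rw [← sub_zero (0 : Space L)]
    nth_rewrite 1 [← h1]
    rw [← h2]
    push_cast
    module
  simp only [smul_eq_zero, Finsupp.single_eq_zero, one_ne_zero, or_false, mul_eq_zero,
    OfNat.ofNat_ne_zero, false_or] at h3
  linear_combination -h3

theorem coeff_nop_identity {V : Type*} [AddCommGroup V] [Module ℂ V] (A : VertexOperator ℂ V)
    {T : VertexOperator ℂ V} (hT : ∀ K, coeff T K = if K = 0 then (1 : Module.End ℂ V) else 0)
    (m : ℤ) : coeff (nop A T) m = coeff A m := by
  have hcomm : ∀ i j v, coeff A i (coeff T j v) = coeff T j (coeff A i v) := by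
    intro i j v
    rw [hT]
    split_ifs <;> simp
  refine LinearMap.ext fun v => ?_
  rw [coeff_nop_apply_of_commute hcomm, finsum_eq_single _ m]
  · simp [hT, -VertexOperator.coeff_eq_ncoeff]
  · intro i hi
    rw [hT, if_neg (by omega), LinearMap.zero_apply, map_zero]

/-- The commutator of the modes of `:a e^δ:` and `:c e^{-δ}:` for isotropic `δ`: as
`e^δ e^{-δ} = 1` and `∂e^δ e^{-δ} = δ(z)`, it is again a Heisenberg mode plus a scalar. -/
theorem ncoeff_current_neg {B : LinearMap.BilinForm ℤ L} (hB : B.IsSymm) (ε : Cocycle B)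
    (a c : Cartan L) {δ : L} (hδ : B δ δ = 0) {k' : ℂ}
    (hk' : k' = form B a (incl δ) * form B c (incl δ) + form B a c) (m n : ℤ) (v : Space L) :
    ncoeff (current B ε a δ) m (ncoeff (current B ε c (-δ)) n v) =
      ncoeff (current B ε c (-δ)) n (ncoeff (current B ε a δ) m v) +
        heisMode B (k' • incl δ + (-form B a (incl δ)) • c + (-form B c (incl δ)) • a) (m + n) v +
        (if m + n = 0 then (m : ℂ) * k' else 0) • v := by
  have h := coeff_nop_coeff_nop (coeff_heis_comm hB a c) (coeff_heis_vertexOp hB ε a (-δ))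
    (coeff_heis_vertexOp hB ε c δ) (coeff_heis_vertexOp hB ε c (-δ)) (vertexOp_comm_neg hB ε hδ)
    (-m - 1) (-n - 1) v
  rw [coeff_nop_identity _ (coeff_nop_vertexOp_neg hB ε hδ),
    coeff_nop_identity _ (coeff_nop_vertexOp_neg hB ε hδ), coeff_heis, coeff_heis,
    coeff_nop_vertexOp_neg hB ε hδ, coeff_nop_eulerDeriv_vertexOp_neg hB ε hδ,
    show -(-m - 1 + (-n - 1) + 1) - 1 = m + n by ring,
    show -(-m - 1 + (-n - 1) + 2) = m + n by ring, form_incl_neg] at h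
  simp only [VertexOperator.ncoeff_apply]
  rw [h, heisMode_add, heisMode_add, heisMode_smul, heisMode_smul, heisMode_smul]
  simp only [LinearMap.add_apply, LinearMap.smul_apply]
  by_cases h0 : m + n = 0
  · rw [if_pos (by omega), if_pos h0, hk', Module.End.one_apply]
    push_cast
    module
  · rw [if_neg (by omega), if_neg h0, hk', LinearMap.zero_apply]
    module

/-- If `(b|δ) = 2` for a lattice vector `δ`, then the modes of `b(z)` are linearly independent modulo
scalars. -/
theorem heisMode_linearIndependent_mod_scalars {B : LinearMap.BilinForm ℤ L} (hB : B.IsSymm)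
    {b : Cartan L} {δ : L} (hb : form B b (incl δ) = 2) (g : ℤ →₀ ℂ) (d : ℂ)
    (h : Finsupp.linearCombination ℂ (heisMode B b) g + d • (1 : Module.End ℂ (Space L)) = 0) :
    g = 0 := by
  -- Bracketing with `δ_(-m)` isolates the coefficient of `b_(m)`.
  have hcomm : ∀ (m : ℤ) (v : Space L), Finsupp.linearCombination ℂ (heisMode B b) g
      (heisMode B (incl δ) (-m) v) =
      heisMode B (incl δ) (-m) (Finsupp.linearCombination ℂ (heisMode B b) g v) +
        (2 * (m : ℂ) * g m) • v := by
    intro m v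
    clear h
    induction g using Finsupp.induction_linear with
    | zero => simp
    | add g g' hg hg' =>
      simp only [map_add, LinearMap.add_apply, hg, hg', Finsupp.add_apply]
      module
    | single n c =>
      simp only [Finsupp.linearCombination_single, LinearMap.smul_apply]
      rw [heisMode_comm B hB, hb, map_smul, smul_add, smul_smul]
      congr 2
      by_cases hnm : n = m
      · subst hnm
        simp
        ring
      · rw [if_neg (by omega), Finsupp.single_eq_of_ne (Ne.symm hnm)]
        simp
  have h1 : ∀ v, Finsupp.linearCombination ℂ (heisMode B b) g v = -(d • v) := fun v =>
    eq_neg_of_add_eq_zero_left (LinearMap.congr_fun h v)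
  have hg : ∀ m, m ≠ 0 → g m = 0 := by
    intro m hm
    have h2 := hcomm m (Finsupp.single 0 1)
    rw [h1, h1] at h2
    simp only [map_neg, map_smul, left_eq_add, smul_eq_zero, Finsupp.single_eq_zero, one_ne_zero,
      or_false, mul_eq_zero, OfNat.ofNat_ne_zero, false_or, Int.cast_eq_zero] at h2
    exact h2.resolve_left hm
  have hsingle : g = Finsupp.single 0 (g 0) := by
    ext m
    by_cases hm : m = 0
    · rw [hm, Finsupp.single_eq_same]
    · rw [hg m hm, Finsupp.single_eq_of_ne hm]
  rw [hsingle] at h1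
  simp only [Finsupp.linearCombination_single] at h1
  -- The zero mode is not detected by brackets, but it has different eigenvalues on `e^0 ⊗ 1` and
  -- `e^δ ⊗ 1`.
  have hvac : ∀ μ : L, g 0 * form B b (incl μ) = -d := by
    intro μ
    have h2 := h1 (Finsupp.single μ 1)
    rw [LinearMap.smul_apply, heisMode_zero_single, smul_smul, ← neg_smul] at h2
    exact smul_left_injective ℂ (by simp) h2
  have h0 := hvac 0
  have hδ := hvac δ
  rw [show incl (0 : L) = 0 from TensorProduct.tmul_zero _ _, LinearMap.map_zero, mul_zero] at h0
  rw [hb, ← h0] at hδ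
  rw [hsingle, Finsupp.single_eq_zero]
  simpa using hδ

end LatticeVertexAlgebra

/-! ### Relations equivalent to an embedding -/

namespace LatticeVertexAlgebra

open FieldCalculus
open HVertexOperator (coeff)
open VertexOperator (ncoeff)

variable {L : Type*} [AddCommGroup L]

attribute [local instance] LieRing.ofAssociativeRing

set_option maxHeartbeats 1000000 in
/-- Necessary conditions for the three fields to generate the affine algebra, before the
normalization of `(α|δ)`. -/
theorem relations_of_isEmbedding {B : LinearMap.BilinForm ℤ L} (hB : B.IsSymm) (ε : Cocycle B)
    {k : ℂ} {δ : L} (hδ : B δ δ = 0) {α β γ : Cartan L}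
    (hemb : AffineSl2.IsEmbedding k (current B ε α δ) (heis B β) (current B ε γ (-δ))) :
    form B β (incl δ) = 2 ∧ form B α α = form B α (incl δ) ^ 2 ∧
      form B γ γ = form B γ (incl δ) ^ 2 ∧
      k = form B α (incl δ) * form B γ (incl δ) + form B α γ ∧
      β = k • incl δ + (-form B α (incl δ)) • γ + (-form B γ (incl δ)) • α := by
  obtain ⟨ρ, hE, hH, hF, hK, hker⟩ := hemb
  have hcomm : ∀ (x y : AffineSl2.Affine) (v : Space L),
      ρ x (ρ y v) = ρ y (ρ x v) + ρ ⁅x, y⁆ v := by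
    intro x y v
    rw [LieHom.map_lie, Ring.lie_def, LinearMap.sub_apply, Module.End.mul_apply,
      Module.End.mul_apply, add_sub_cancel]
  -- Otherwise `[h_(0), e_(0)] = 2 e_(0)` forces `e_(0) = 0`, but `e t⁰` is not in `ℂ K`.
  have hβδ : form B β (incl δ) = 2 := by
    have hE0 : ncoeff (current B ε α δ) 0 ≠ 0 := by
      rw [← hE]
      exact fun h0 => AffineSl2.loop_e_notMem_span 0 (hker _ h0)
    by_contra hne
    refine hE0 (LinearMap.ext fun v => ?_)
    have h1 := hcomm (AffineSl2.loop AffineSl2.h 0) (AffineSl2.loop AffineSl2.e 0) v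
    rw [AffineSl2.lie_loop_h_e, map_smul, LinearMap.smul_apply, add_zero, hE, hH, ncoeff_heis,
      heisMode_ncoeff_current hB, Int.cast_zero, zero_mul, zero_smul, add_zero, add_zero,
      add_right_inj, ← sub_eq_zero, ← sub_smul, smul_eq_zero] at h1
    exact h1.resolve_left (sub_ne_zero.2 hne)
  have hαα : form B α α = form B α (incl δ) ^ 2 := by
    refine form_self_eq_of_comm hB ε hδ fun N M v => ?_
    have h1 := hcomm (AffineSl2.loop AffineSl2.e (-N - 1)) (AffineSl2.loop AffineSl2.e (-M - 1)) v
    rw [AffineSl2.lie_loop_e_e, map_zero, LinearMap.zero_apply, add_zero, hE, hE] at h1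
    simpa using h1
  have hγγ : form B γ γ = form B γ (incl δ) ^ 2 := by
    rw [← neg_sq, ← form_incl_neg]
    refine form_self_eq_of_comm hB ε (by simpa using hδ) fun N M v => ?_
    have h1 := hcomm (AffineSl2.loop AffineSl2.f (-N - 1)) (AffineSl2.loop AffineSl2.f (-M - 1)) v
    rw [AffineSl2.lie_loop_f_f, map_zero, LinearMap.zero_apply, add_zero, hF, hF] at h1
    simpa using h1
  have hEF : ∀ m n v, heisMode B β (m + n) v + (if m + n = 0 then (m : ℂ) * k else 0) • v =
      heisMode B ((form B α (incl δ) * form B γ (incl δ) + form B α γ) • incl δ +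
        (-form B α (incl δ)) • γ + (-form B γ (incl δ)) • α) (m + n) v +
      (if m + n = 0 then
        (m : ℂ) * (form B α (incl δ) * form B γ (incl δ) + form B α γ) else 0) • v := by
    intro m n v
    have h1 := hcomm (AffineSl2.loop AffineSl2.e m) (AffineSl2.loop AffineSl2.f n) v
    rw [AffineSl2.lie_loop_e_f, map_add, map_smul, hK, hE, hF, hH, ncoeff_heis,
      ncoeff_current_neg hB ε α γ hδ rfl, add_assoc, add_right_inj] at h1
    rw [h1, LinearMap.add_apply, LinearMap.smul_apply, LinearMap.smul_apply, Module.End.one_apply,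
      smul_smul, ite_mul, zero_mul]
  -- For `m + n ≠ 0` there is no central term, and the mode `-1` recovers the vector of `𝔥`.
  have hmode := hEF 0 (-1) (Finsupp.single 0 1)
  rw [if_neg (by norm_num), if_neg (by norm_num), add_left_inj, zero_add] at hmode
  have hβ := eq_of_heisMode_neg_one hmode
  -- For `m + n = 0` the Heisenberg modes cancel, and the scalars remain.
  have hk := hEF 1 (-1) (Finsupp.single 0 1)
  rw [← hβ, add_right_inj, if_pos (by norm_num), if_pos (by norm_num), Int.cast_one, one_mul,
    one_mul] at hk
  have hvac : (Finsupp.single 0 1 : Space L) ≠ 0 := Finsupp.single_ne_zero.2 one_ne_zero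
  have hk' := smul_left_injective ℂ hvac hk
  exact ⟨hβδ, hαα, hγγ, hk', by rw [hk']; exact hβ⟩

set_option maxHeartbeats 1000000 in
/-- The relations on the lattice vectors under which the three fields generate the affine
algebra. -/
theorem isEmbedding_of_relations {B : LinearMap.BilinForm ℤ L} (hB : B.IsSymm) (ε : Cocycle B)
    {k : ℂ} {δ : L} (hδ : B δ δ = 0) {α β γ : Cartan L}
    (hβδ : form B β (incl δ) = 2) (hβα : form B β α = 0) (hβγ : form B β γ = 0)
    (hββ : form B β β = 2 * k)
    (hαα : form B α α = form B α (incl δ) ^ 2) (hγγ : form B γ γ = form B γ (incl δ) ^ 2)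
    (hk : k = form B α (incl δ) * form B γ (incl δ) + form B α γ)
    (hβ : β = k • incl δ + (-form B α (incl δ)) • γ + (-form B γ (incl δ)) • α) :
    AffineSl2.IsEmbedding k (current B ε α δ) (heis B β) (current B ε γ (-δ)) := by
  obtain ⟨ρ, hE, hH, hF, hK⟩ := AffineSl2.exists_representation k (ncoeff (current B ε α δ))
    (heisMode B β) (ncoeff (current B ε γ (-δ)))
    (fun m n => AffineSl2.lie_eq_of_apply fun v => by
      simp only [VertexOperator.ncoeff_apply]
      rw [coeff_current_self hB ε α hδ, hαα, sub_self, zero_smul, LinearMap.zero_apply])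
    (fun m n => AffineSl2.lie_eq_of_apply fun v => by
      simp only [VertexOperator.ncoeff_apply]
      rw [coeff_current_self hB ε γ (by simpa using hδ), hγγ, form_incl_neg, neg_sq, sub_self,
        zero_smul, LinearMap.zero_apply])
    (fun m n => AffineSl2.lie_eq_of_apply fun v => by
      rw [heisMode_ncoeff_current hB, hβδ, hβα, mul_zero, zero_smul, add_zero,
        LinearMap.smul_apply])
    (fun m n => AffineSl2.lie_eq_of_apply fun v => by
      rw [heisMode_ncoeff_current hB, form_incl_neg, hβδ, hβγ, mul_zero, zero_smul, add_zero,
        LinearMap.smul_apply])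
    (fun m n => AffineSl2.lie_eq_of_apply fun v => by
      rw [heisMode_comm B hB, hββ, LinearMap.smul_apply, Module.End.one_apply, mul_left_comm,
        mul_assoc])
    (fun m n => AffineSl2.lie_eq_of_apply fun v => by
      have h1 := ncoeff_current_neg hB ε α γ hδ hk m n v
      rw [← hβ, add_assoc] at h1
      exact h1)
  refine ⟨ρ, hE, fun n => by rw [hH, ncoeff_heis], hF, hK, fun u hu =>
    AffineSl2.mem_span_K_of_eq_zero ρ (fun b d h0 => ?_) hu⟩
  refine heisMode_linearIndependent_mod_scalars hB hβδ b (d * k) ?_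
  rw [map_add, map_smul, hK, smul_smul] at h0
  rw [← h0]
  congr 1
  clear h0
  induction b using Finsupp.induction_linear with
  | zero => simp
  | add b b' h h' => rw [map_add, map_add, map_add, h, h']
  | single n c => rw [Finsupp.linearCombination_single, Finsupp.linearCombination_single, map_smul, hH]

end LatticeVertexAlgebra

end

theorem theorem2p1 {L : Type*} [AddCommGroup L] [Module.Free ℤ L] [Module.Finite ℤ L]
    (B : LinearMap.BilinForm ℤ L) (hB : B.IsSymm) (ε : LatticeVertexAlgebra.Cocycle B) (k : ℂ)
    (δ : L) (hδ : B δ δ = 0) (α β γ : LatticeVertexAlgebra.Cartan L)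
    (hspan : Submodule.span ℂ {α, β, γ, LatticeVertexAlgebra.incl δ} = ⊤) :
    AffineSl2.IsEmbedding k
        (FieldCalculus.nop (LatticeVertexAlgebra.heis B α) (LatticeVertexAlgebra.vertexOp B ε δ))
        (LatticeVertexAlgebra.heis B β)
        (FieldCalculus.nop (LatticeVertexAlgebra.heis B γ)
          (LatticeVertexAlgebra.vertexOp B ε (-δ))) ↔
      ∃ (lam : ℂ) (α' γ' : LatticeVertexAlgebra.Cartan L),
        lam ≠ 0 ∧ α' = lam • α ∧ γ' = lam⁻¹ • γ ∧
        β = k • LatticeVertexAlgebra.incl δ + α' - γ' ∧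
        LatticeVertexAlgebra.form B (LatticeVertexAlgebra.incl δ) (LatticeVertexAlgebra.incl δ) = 0 ∧
        LatticeVertexAlgebra.form B α' γ' = k + 1 ∧
        LatticeVertexAlgebra.form B α' α' = 1 ∧
        LatticeVertexAlgebra.form B γ' γ' = 1 ∧
        LatticeVertexAlgebra.form B (LatticeVertexAlgebra.incl δ) α' = 1 ∧
        LatticeVertexAlgebra.form B (LatticeVertexAlgebra.incl δ) γ' = -1 := by
  have hδδ : LatticeVertexAlgebra.form B (LatticeVertexAlgebra.incl δ)
      (LatticeVertexAlgebra.incl δ) = 0 := by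
    rw [LatticeVertexAlgebra.form_incl, hδ, Int.cast_zero]
  have hsymm := LatticeVertexAlgebra.form_comm hB
  constructor
  · intro hemb
    obtain ⟨h2, hαα, hγγ, hk, hβ⟩ :=
      LatticeVertexAlgebra.relations_of_isEmbedding hB ε hδ hemb
    set a := LatticeVertexAlgebra.form B α (LatticeVertexAlgebra.incl δ) with ha
    set c := LatticeVertexAlgebra.form B γ (LatticeVertexAlgebra.incl δ) with hc
    -- Pairing the formula for `β` with `δ` gives `2 = -2 (α|δ) (γ|δ)`.
    have hac : a * c = -1 := by
      rw [hβ] at h2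
      simp only [map_add, map_smul, LinearMap.add_apply, LinearMap.smul_apply, smul_eq_mul, hδδ,
        ← ha, ← hc] at h2
      linear_combination -h2 / 2
    have ha0 : a ≠ 0 := fun h0 => by simp [h0] at hac
    have hc' : -c = a⁻¹ := by
      refine eq_inv_of_mul_eq_one_left ?_
      linear_combination -hac
    -- The rescaling that makes `(α|δ) = 1`.
    refine ⟨a⁻¹, _, _, inv_ne_zero ha0, rfl, rfl, ?_, hδδ, ?_, ?_, ?_, ?_, ?_⟩
    · rw [hβ, hc', inv_inv]
      module
    · simp only [map_smul, LinearMap.smul_apply, smul_eq_mul, inv_inv]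
      rw [mul_inv_cancel_left₀ ha0]
      linear_combination -hk - hac
    · simp only [map_smul, LinearMap.smul_apply, smul_eq_mul, hαα]
      field_simp
    · simp only [map_smul, LinearMap.smul_apply, smul_eq_mul, hγγ, inv_inv]
      linear_combination (a * c - 1) * hac
    · rw [map_smul, hsymm, ← ha, smul_eq_mul, inv_mul_cancel₀ ha0]
    · rw [map_smul, hsymm, ← hc, smul_eq_mul, inv_inv, hac]
  · rintro ⟨lam, α', γ', hlam, hα', hγ', hβ, -, hαγ, hαα, hγγ, hδα, hδγ⟩
    obtain rfl : α = lam⁻¹ • α' := by rw [hα', inv_smul_smul₀ hlam]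
    obtain rfl : γ = lam • γ' := by rw [hγ', smul_inv_smul₀ hlam]
    have hαδ := (hsymm α' (LatticeVertexAlgebra.incl δ)).trans hδα
    have hγδ := (hsymm γ' (LatticeVertexAlgebra.incl δ)).trans hδγ
    have hγα := (hsymm γ' α').trans hαγ
    subst hβ
    refine LatticeVertexAlgebra.isEmbedding_of_relations hB ε hδ ?_ ?_ ?_ ?_ ?_ ?_ ?_ ?_ <;>
    simp only [map_add, map_sub, map_smul, LinearMap.add_apply, LinearMap.sub_apply,
      LinearMap.smul_apply, smul_eq_mul, hδδ, hαγ, hαα, hγγ, hδα, hδγ, hαδ, hγδ, hγα]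
    · ring
    · ring
    · ring
    · ring
    · ring
    · ring
    · field_simp
      ring
    · rw [smul_smul, smul_smul, mul_one, mul_neg_one, neg_neg, mul_inv_cancel₀ hlam, neg_mul,
        inv_mul_cancel₀ hlam]
      module
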